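/- Let $X$ be a smooth Riemannian manifold with Levi-Civita connection $\nabla^{TX}$, let $W$ be a real Euclidean vector bundle over $X$ of rank $2l$ with a Euclidean connection $\nabla^W$ and curvature $R^W$, and let $\xi$ be an oriented real Euclidean vector bundle of rank $2$ over $X$ with a Euclidean connection $\nabla^\xi$ and Euler form $c=e(\xi,\nabla^\xi)$. Write $$\widehat A=\widehat A(TX)=\det{}^{1/2}\left(\frac{\frac{\sqrt{-1}}{4\pi}R^{TX}}{\sinh\left(\frac{\sqrt{-1}}{4\pi}R^{TX}\right)}\right),\quad D=\det{}^{1/2}\left(2\cosh\left(\tfrac{\sqrt{-1}}{4\pi}R^W\right)\right),\quad \mathrm{ch}(W_{\mathbf C})=\mathrm{tr}\exp\left(\tfrac{\sqrt{-1}}{2\pi}R^{W}\right),$$ and $p=p_1(TX,\nabla^{TX})-p_1(W,\nabla^W)$, where $p_1=-\frac{1}{8\pi^2}\mathrm{tr}(R^2)$. Here $\det^{1/2}(f(R))=a^{r/2}\exp\left(\tfrac12\mathrm{tr}\log(a^{-1}f(R))\right)$ for a power series $f$ with constant term $a>0$ and $R$ of size $r$. Let $\{\omega\}^{(j)}$ denote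 the degree $j$ component of a differential form $\omega$; functions of forms of positive even degree are defined by their Taylor series, and $\frac{e^{p/24}-1}{p}$ means $\sum_{k\ge 0}\frac{p^k}{24^{k+1}(k+1)!}$. Put $$K_8=-2^{l-4}\mathrm{ch}(W_{\mathbf C})+2^{l-3}(l+8),\qquad K_8^\xi=K_8+3\cdot2^{l-4}(e^c+e^{-c}-2),$$ $$K_{12}=2^{l-3}\mathrm{ch}(W_{\mathbf C})-2^{l-2}(l-4),\qquad K_{12}^\xi=K_{12}-3\cdot2^{l-3}(e^c+e^{-c}-2).$$ Then the following identities of differential forms hold on $X$. (1) If $\dim X=4$, then $$\left\{\frac{\widehat A D}{\cosh^2(c/2)}\right\}^{(4)}+2^{l+1}\left\{\widehat A\cosh\left(\tfrac c2\right)\right\}^{(4)}=-2^{l-3}p,\qquad \left\{\widehat A D\right\}^{(4)}+2^{l+1}\left\{\widehat A\right\}^{(4)}=-2^{l-3}p.$$ (2) If $\dim X=8$, then $$\left\{\frac{\widehat A D}{\cosh^2(c/2)}\right\}^{(8)}-\left\{\widehat A K_8^\xi\cosh\left(\tfrac c2\right)\right\}^{(8)}=p\cdot\left\{\frac{e^{p/24}-1}{p}\left[\widehat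 A\cosh\left(\tfrac c2\right)K_8^\xi-\frac{\widehat A D}{\cosh^2(c/2)}\right]\right\}^{(4)},$$ $$\left\{\widehat A D\right\}^{(8)}-\left\{\widehat A K_8\right\}^{(8)}=p\cdot\left\{\frac{e^{p/24}-1}{p}\left[\widehat A K_8-\widehat A D\right]\right\}^{(4)}.$$ (3) If $\dim X=12$, then $$\left\{\frac{\widehat A D}{\cosh^2(c/2)}\right\}^{(12)}-\left\{\widehat A K_{12}^\xi\cosh\left(\tfrac c2\right)\right\}^{(12)}=p\cdot\left\{\frac{e^{p/24}-1}{p}\left[\widehat A\cosh\left(\tfrac c2\right)K_{12}^\xi-\frac{\widehat A D}{\cosh^2(c/2)}\right]\right\}^{(8)},$$ $$\left\{\widehat A D\right\}^{(12)}-\left\{\widehat A K_{12}\right\}^{(12)}=p\cdot\left\{\frac{e^{p/24}-1}{p}\left[\widehat A K_{12}-\widehat A D\right]\right\}^{(8)}.$$ Moreover, the following equivalent forms of these six identities hold: in the respective dimensions, $$\left\{e^{p/24}\left[\frac{\widehat A D}{\cosh^2(c/2)}+2^{l+1}\widehat A\cosh\left(\tfrac c2\right)\right]\right\}^{(4)}=0,\qquad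 \left\{e^{p/24}\left[\widehat A D+2^{l+1}\widehat A\right]\right\}^{(4)}=0,$$ $$\left\{e^{p/24}\left[\frac{\widehat A D}{\cosh^2(c/2)}-\widehat A\cosh\left(\tfrac c2\right)K_8^\xi\right]\right\}^{(8)}=0,\qquad \left\{e^{p/24}\left[\widehat A D-\widehat A K_8\right]\right\}^{(8)}=0,$$ $$\left\{e^{p/24}\left[\frac{\widehat A D}{\cosh^2(c/2)}-\widehat A\cosh\left(\tfrac c2\right)K_{12}^\xi\right]\right\}^{(12)}=0,\qquad \left\{e^{p/24}\left[\widehat A D-\widehat A K_{12}\right]\right\}^{(12)}=0.$$ -/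

import Mathlib

open Bundle FiberBundle
open scoped Manifold ContDiff Topology

noncomputable section

namespace Anomaly

/-! ### Differential forms at a point -/

/-- Complex-valued exterior forms on a real vector space `T`: the exterior algebra of
`Hom_ℝ(T, ℂ) = T* ⊗ ℂ`. For `T = T_x X` this is the fibre at `x` of the bundle of complex
differential forms, and its product is the wedge product. -/
abbrev Form (T : Type*) [AddCommGroup T] [Module ℝ T] : Type _ :=
  ExteriorAlgebra ℂ (T →ₗ[ℝ] ℂ)

section Forms

variable {T : Type*} [AddCommGroup T] [Module ℝ T]

/-- The degree `j` component `η^{(j)}` of a form `η`. -/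
def degreePart (j : ℕ) (η : Form T) : Form T :=
  GradedRing.proj (fun i : ℕ => ⋀[ℂ]^i (T →ₗ[ℝ] ℂ)) j η

/-- The one-form `e^i` of the basis dual to `e`. -/
def dualForm {ι : Type*} (e : Module.Basis ι ℝ T) (i : ι) : Form T :=
  ExteriorAlgebra.ι ℂ (Complex.ofRealAm.toLinearMap ∘ₗ e.coord i)

/-- The element `∑_{i<j} η(e_i, e_j) e^i ∧ e^j` of `Λ²(T* ⊗ ℂ)` that corresponds to an alternating
real bilinear form `η` on `T`. -/
def twoForm [FiniteDimensional ℝ T] (η : T → T → ℝ) : Form T :=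
  let e := Module.finBasis ℝ T
  ∑ i, ∑ j ∈ Finset.Ioi i, (η (e i) (e j) : ℂ) • (dualForm e i * dualForm e j)

end Forms

/-! ### Power series of nilpotent elements -/

/-- `f(a) = ∑_k f_k a^k` for a formal power series `f = ∑_k f_k z^k`; it is meant for nilpotent `a`,
where the sum is finite. Below, `a` is a form without component in degree `0`, or a matrix of such
forms. -/
def evalSeries {A : Type*} [Ring A] [Algebra ℂ A] (f : PowerSeries ℂ) (a : A) : A :=
  ∑ᶠ k : ℕ, PowerSeries.coeff k f • a ^ k

/-- `exp z`. -/
def expSeries : PowerSeries ℂ := PowerSeries.mk fun k => ((k.factorial : ℂ))⁻¹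

/-- `cosh z`. -/
def coshSeries : PowerSeries ℂ :=
  PowerSeries.mk fun k => if Even k then ((k.factorial : ℂ))⁻¹ else 0

/-- `sinh z / z`. -/
def sinhDivSeries : PowerSeries ℂ :=
  PowerSeries.mk fun k => if Even k then (((k + 1).factorial : ℂ))⁻¹ else 0

/-- `log (1 + z)`. -/
def logOneAddSeries : PowerSeries ℂ :=
  PowerSeries.mk fun k => if k = 0 then 0 else (-1) ^ (k + 1) / (k : ℂ)

/-- `(exp (z / 24) - 1) / z`. -/
def expSubOneDivSeries : PowerSeries ℂ :=
  PowerSeries.mk fun k => (1 / 24) ^ (k + 1) / ((k + 1).factorial : ℂ)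

/-- `det^{1/2}(f(R))`, for a power series `f` with constant term `a ≠ 0` and a matrix `R` of size `r`
whose entries are two-forms. Here `f(R) = a (1 + N)` with `N` nilpotent, and the square root of the
determinant, with constant term `a^{r/2}`, is `a^{r/2} exp(½ tr log(1 + N))`. -/
def detSqrt {ι A : Type*} [Fintype ι] [DecidableEq ι] [Ring A] [Algebra ℂ A]
    (f : PowerSeries ℂ) (R : Matrix ι ι A) : A :=
  let a : ℂ := PowerSeries.constantCoeff f
  a ^ ((Fintype.card ι : ℂ) / 2) •
    evalSeries expSeries
      ((1 / 2 : ℂ) • (evalSeries logOneAddSeries (a⁻¹ • evalSeries f R - 1)).trace)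

/-! ### Connections, curvature and characteristic forms -/

section Connections

variable {E : Type*} [NormedAddCommGroup E] [NormedSpace ℝ E]
  {H : Type*} [TopologicalSpace H] {I : ModelWithCorners ℝ E H}
  {X : Type*} [TopologicalSpace X] [ChartedSpace H X] [IsManifold I ∞ X]
  {F : Type*} [NormedAddCommGroup F] [NormedSpace ℝ F]
  {V : X → Type*} [TopologicalSpace (TotalSpace F V)]
  [∀ x, NormedAddCommGroup (V x)] [∀ x, InnerProductSpace ℝ (V x)]
  [FiberBundle F V] [VectorBundle ℝ F V]

/-- The curvature `R(u,v)w = ∇_u ∇_v w - ∇_v ∇_u w - ∇_{[u,v]} w` at a point `x`. The vectors `u`,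
`v`, `w` at `x` are extended to local smooth sections (the value does not depend on the
extensions). In Mathlib's order of arguments, `D σ x u` is `∇_u σ` at `x`. -/
def curvature (D : CovariantDerivative I F V) (x : X) (u v : TangentSpace I x) (w : V x) : V x :=
  D (fun y => D (extend F w) y (extend E v y)) x u
    - D (fun y => D (extend F w) y (extend E u y)) x v
    - D (extend F w) x (VectorField.mlieBracket I (extend E u) (extend E v) x)

/-- The Levi-Civita connection of a Riemannian manifold: metric and torsion free. -/
structure IsLeviCivita [FiniteDimensional ℝ E]
    [RiemannianBundle (fun x : X => TangentSpace I x)]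
    [IsContMDiffRiemannianBundle I ∞ E (fun x : X => TangentSpace I x)]
    (D : CovariantDerivative I E (fun x : X => TangentSpace I x)) : Prop where
  metric : CovariantDerivative.IsMetricCompatible (V := fun x : X => TangentSpace I x) D
  torsion_free : CovariantDerivative.torsion D = 0

/-- An orthonormal basis of the fibre `V x` of a Euclidean vector bundle. -/
def frame (F : Type*) [NormedAddCommGroup F] [NormedSpace ℝ F] [FiniteDimensional ℝ F]
    {V : X → Type*} [TopologicalSpace (TotalSpace F V)]
    [∀ x, NormedAddCommGroup (V x)] [∀ x, InnerProductSpace ℝ (V x)]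
    [FiberBundle F V] [VectorBundle ℝ F V] (x : X) :
    OrthonormalBasis (Fin (Module.finrank ℝ F)) ℝ (V x) :=
  haveI : FiniteDimensional ℝ (V x) := VectorBundle.finiteDimensional ℝ F V x
  (stdOrthonormalBasis ℝ (V x)).reindex (finCongr (VectorBundle.finrank_eq ℝ F V x))

variable [FiniteDimensional ℝ E] [FiniteDimensional ℝ F]

instance (x : X) : FiniteDimensional ℝ (TangentSpace I x) :=
  inferInstanceAs (FiniteDimensional ℝ E)

/-- The matrix of two-forms `⟨e_a, R e_b⟩` at `x` of the curvature `R` of a connection on a Euclidean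
vector bundle, in an orthonormal basis of the fibre. It is also the curvature matrix of the induced
connection on the complexified bundle. -/
def curvatureMatrix (D : CovariantDerivative I F V) (x : X) :
    Matrix (Fin (Module.finrank ℝ F)) (Fin (Module.finrank ℝ F)) (Form (TangentSpace I x)) :=
  Matrix.of fun a b =>
    twoForm fun u v => inner ℝ (frame F x a : V x) (curvature D x u v (frame F x b))

/-- `Â(V, ∇) = det^{1/2}(((i/4π) R) / sinh((i/4π) R))`. -/
def aHat (D : CovariantDerivative I F V) (x : X) : Form (TangentSpace I x) :=
  detSqrt sinhDivSeries⁻¹ ((Complex.I / (4 * Real.pi)) • curvatureMatrix D x)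

/-- `det^{1/2}(2 cosh((i/4π) R))`. -/
def detTwoCosh (D : CovariantDerivative I F V) (x : X) : Form (TangentSpace I x) :=
  detSqrt ((2 : ℂ) • coshSeries) ((Complex.I / (4 * Real.pi)) • curvatureMatrix D x)

/-- The Chern character form `ch(V_ℂ) = tr exp((i/2π) R)` of the complexification of `V`. -/
def chComplexified (D : CovariantDerivative I F V) (x : X) : Form (TangentSpace I x) :=
  (evalSeries expSeries ((Complex.I / (2 * Real.pi)) • curvatureMatrix D x)).trace

/-- The first Pontryagin form `p_1(V, ∇) = -(1/8π²) tr(R²)`. -/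
def pontryagin₁ (D : CovariantDerivative I F V) (x : X) : Form (TangentSpace I x) :=
  (-(1 / (8 * (Real.pi : ℂ) ^ 2))) • (curvatureMatrix D x ^ 2).trace

end Connections

/-! ### Oriented bundles of rank two -/

section Euler

variable {E : Type*} [NormedAddCommGroup E] [NormedSpace ℝ E] [FiniteDimensional ℝ E]
  {H : Type*} [TopologicalSpace H] {I : ModelWithCorners ℝ E H}
  {X : Type*} [TopologicalSpace X] [ChartedSpace H X] [IsManifold I ∞ X]
  {V : X → Type*} [TopologicalSpace (TotalSpace (EuclideanSpace ℝ (Fin 2)) V)]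
  [∀ x, NormedAddCommGroup (V x)] [∀ x, InnerProductSpace ℝ (V x)]
  [FiberBundle (EuclideanSpace ℝ (Fin 2)) V] [VectorBundle ℝ (EuclideanSpace ℝ (Fin 2)) V]

/-- A family of orientations of the fibres is an orientation of the bundle if it is locally constant
in local trivializations. -/
def IsBundleOrientation (o : ∀ x, Orientation ℝ (V x) (Fin 2)) : Prop :=
  ∀ x₀ : X, ∃ U ∈ 𝓝 x₀, ∃ o₀ : Orientation ℝ (EuclideanSpace ℝ (Fin 2)) (Fin 2),
    ∀ (x : X) (hx : x ∈ (trivializationAt (EuclideanSpace ℝ (Fin 2)) V x₀).baseSet), x ∈ U →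
      Orientation.map (Fin 2)
        ((trivializationAt (EuclideanSpace ℝ (Fin 2)) V x₀).linearEquivAt ℝ x hx) (o x) = o₀

/-- A positively oriented orthonormal basis of the fibre at `x`. -/
def orientedFrame (o : ∀ x, Orientation ℝ (V x) (Fin 2)) (x : X) :
    OrthonormalBasis (Fin 2) ℝ (V x) :=
  (o x).finOrthonormalBasis two_pos
    ((VectorBundle.finrank_eq ℝ (EuclideanSpace ℝ (Fin 2)) V x).trans finrank_euclideanSpace_fin)

/-- The Euler form `e(V, ∇) = (1/2π) ⟨e_1, R e_2⟩` of an oriented Euclidean bundle of rank two, in a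
positively oriented orthonormal basis `(e_1, e_2)` of the fibre. -/
def eulerForm (o : ∀ x, Orientation ℝ (V x) (Fin 2))
    (D : CovariantDerivative I (EuclideanSpace ℝ (Fin 2)) V) (x : X) : Form (TangentSpace I x) :=
  (1 / (2 * (Real.pi : ℂ))) •
    twoForm fun u v => inner ℝ (orientedFrame o x 0) (curvature D x u v (orientedFrame o x 1))

end Euler

end Anomaly

end

/-!
All forms in the statement are polynomials, at the point `x`, in traces of powers of the curvature
matrices `R^{TX}`, `R^W` and in the Euler form `c`, and the identities hold between these
polynomials. Two-forms are central in the algebra of all forms, so the computation takes place in a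
commutative ring, the ring `CentralForm` of central forms. In dimension at most `12` a form of
degree above `12` vanishes, so every power series is a finite sum, and an element without components
in degrees outside `4ℕ` is given by its components in degrees `0, 4, 8, 12` (`HasComponents`).

With `x_k` and `w_k` the traces of the `2k`-th powers of `(i/4π) R^{TX}` and `(i/4π) R^W`, one has
`p = 2 (x₁ - w₁)`, and

* `Â = exp (-x₁/12 + x₂/360 - x₃/5670)`, because `½ log (z / sinh z)` has these coefficients,
* `det^{1/2}(2 cosh) = 2^l exp (w₁/4 - w₂/24 + w₃/90)`, from `½ log cosh z`,
* `ch(W_ℂ) = 2l + 2 w₁ + (2/3) w₂ + (4/45) w₃` up to traces of odd powers, which have degree `2` mod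
  `4` and do not contribute to the degrees `4`, `8`, `12`.

The factor `exp (p/24)` cancels `x₁` in `Â`, so that `e^{p/24} Â = 1 - w₁/12 + ⋯`. What remains is a
comparison of coefficients in `w₁, w₂, w₃, c²`, carried out in `exists_hasComponents_anomaly`; there
`x₂` and `x₃` only multiply terms that vanish. This proves the six identities with the factor
`e^{p/24}`. The other six follow from `e^{p/24} = 1 + p Q` with `Q = (e^{p/24} - 1)/p`, since `p` is
homogeneous of degree `4` (`degreePart_sub_eq_mul`), and the identities without `ξ` are the case
`c = 0`.
-/

namespace Anomaly

/-! ### Power series and algebra homomorphisms -/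

theorem evalSeries_eq_sum {A : Type*} [Ring A] [Algebra ℂ A] (f : PowerSeries ℂ) {a : A} {N : ℕ}
    (ha : a ^ N = 0) :
    evalSeries f a = ∑ k ∈ Finset.range N, PowerSeries.coeff k f • a ^ k := by
  refine finsum_eq_sum_of_support_subset _ fun k hk => ?_
  by_contra hkN
  have hNk : N ≤ k := by simpa using hkN
  exact hk (by simp [pow_eq_zero_of_le hNk ha])

theorem evalSeries_zero {A : Type*} [Ring A] [Algebra ℂ A] (f : PowerSeries ℂ) :
    evalSeries f (0 : A) = PowerSeries.coeff 0 f • (1 : A) := by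
  simp [evalSeries_eq_sum f (show (0 : A) ^ 1 = 0 by simp)]

/-- Injectivity makes this hold without nilpotency: the junk value `0` of `finsum` occurs on both
sides or on neither. -/
theorem map_evalSeries {A B : Type*} [Ring A] [Algebra ℂ A] [Ring B] [Algebra ℂ B]
    {φ : A →ₐ[ℂ] B} (hφ : Function.Injective φ) (f : PowerSeries ℂ) (a : A) :
    φ (evalSeries f a) = evalSeries f (φ a) := by
  have h := (φ : A →+ B).map_finsum_of_injective hφ fun k : ℕ => PowerSeries.coeff k f • a ^ k
  simpa [evalSeries] using h

theorem mapMatrix_injective {ι A B : Type*} [Fintype ι] [DecidableEq ι] [Ring A] [Algebra ℂ A]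
    [Ring B] [Algebra ℂ B] {φ : A →ₐ[ℂ] B} (hφ : Function.Injective φ) :
    Function.Injective (φ.mapMatrix : Matrix ι ι A →ₐ[ℂ] Matrix ι ι B) := fun M N h => by
  ext i j
  exact hφ (congrFun (congrFun h i) j)

theorem trace_mapMatrix {ι A B : Type*} [Fintype ι] [DecidableEq ι] [Ring A] [Algebra ℂ A] [Ring B]
    [Algebra ℂ B] (φ : A →ₐ[ℂ] B) (N : Matrix ι ι A) : (φ.mapMatrix N).trace = φ N.trace := by
  simp [Matrix.trace]

theorem map_detSqrt {ι A B : Type*} [Fintype ι] [DecidableEq ι] [Ring A] [Algebra ℂ A] [Ring B]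
    [Algebra ℂ B] {φ : A →ₐ[ℂ] B} (hφ : Function.Injective φ) (f : PowerSeries ℂ)
    (M : Matrix ι ι A) : φ (detSqrt f M) = detSqrt f (φ.mapMatrix M) := by
  simp only [detSqrt, map_smul, map_evalSeries hφ, ← trace_mapMatrix,
    map_evalSeries (φ := φ.mapMatrix (m := ι)) (mapMatrix_injective hφ),
    map_sub, map_one]

/-! ### Components in degrees `0, 4, 8, 12` -/

section Graded

variable {S : Type*} [CommRing S] [Algebra ℂ S] (𝒮 : ℕ → Submodule ℂ S)

/-- `a` is the sum of the homogeneous components `a₀, a₁, a₂, a₃` of degrees `0, 4, 8, 12`. -/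
structure HasComponents (a a₀ a₁ a₂ a₃ : S) : Prop where
  mem₀ : a₀ ∈ 𝒮 0
  mem₁ : a₁ ∈ 𝒮 4
  mem₂ : a₂ ∈ 𝒮 8
  mem₃ : a₃ ∈ 𝒮 12
  eq_sum : a = a₀ + a₁ + a₂ + a₃

variable {𝒮}
variable {a a₀ a₁ a₂ a₃ b b₀ b₁ b₂ b₃ : S}

theorem HasComponents.congr (ha : HasComponents 𝒮 a a₀ a₁ a₂ a₃) (h₀ : a₀ = b₀) (h₁ : a₁ = b₁)
    (h₂ : a₂ = b₂) (h₃ : a₃ = b₃) : HasComponents 𝒮 a b₀ b₁ b₂ b₃ := by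
  subst h₀ h₁ h₂ h₃
  exact ha

theorem HasComponents.add (ha : HasComponents 𝒮 a a₀ a₁ a₂ a₃)
    (hb : HasComponents 𝒮 b b₀ b₁ b₂ b₃) :
    HasComponents 𝒮 (a + b) (a₀ + b₀) (a₁ + b₁) (a₂ + b₂) (a₃ + b₃) where
  mem₀ := add_mem ha.mem₀ hb.mem₀
  mem₁ := add_mem ha.mem₁ hb.mem₁
  mem₂ := add_mem ha.mem₂ hb.mem₂
  mem₃ := add_mem ha.mem₃ hb.mem₃
  eq_sum := by rw [ha.eq_sum, hb.eq_sum]; ring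

theorem HasComponents.smul (z : ℂ) (ha : HasComponents 𝒮 a a₀ a₁ a₂ a₃) :
    HasComponents 𝒮 (z • a) (z • a₀) (z • a₁) (z • a₂) (z • a₃) where
  mem₀ := Submodule.smul_mem _ _ ha.mem₀
  mem₁ := Submodule.smul_mem _ _ ha.mem₁
  mem₂ := Submodule.smul_mem _ _ ha.mem₂
  mem₃ := Submodule.smul_mem _ _ ha.mem₃
  eq_sum := by rw [ha.eq_sum]; simp only [smul_add]

theorem HasComponents.sub (ha : HasComponents 𝒮 a a₀ a₁ a₂ a₃)
    (hb : HasComponents 𝒮 b b₀ b₁ b₂ b₃) :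
    HasComponents 𝒮 (a - b) (a₀ - b₀) (a₁ - b₁) (a₂ - b₂) (a₃ - b₃) := by
  simpa [sub_eq_add_neg] using ha.add (hb.smul (-1))

variable [SetLike.GradedMonoid 𝒮]

theorem mul_mem_of_add_eq {i j k : ℕ} (ha : a ∈ 𝒮 i) (hb : b ∈ 𝒮 j) (h : i + j = k) :
    a * b ∈ 𝒮 k :=
  h ▸ SetLike.mul_mem_graded ha hb

theorem pow_mem_of_mul_eq {i k m : ℕ} (ha : a ∈ 𝒮 i) (h : m * i = k) : a ^ m ∈ 𝒮 k := by
  simpa [h] using SetLike.pow_mem_graded m ha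

theorem HasComponents.one : HasComponents 𝒮 1 1 0 0 0 where
  mem₀ := SetLike.one_mem_graded 𝒮
  mem₁ := zero_mem _
  mem₂ := zero_mem _
  mem₃ := zero_mem _
  eq_sum := by simp

theorem mul_eq_zero_of_mem (h𝒮 : ∀ k, 12 < k → 𝒮 k = ⊥) {i j : ℕ} (ha : a ∈ 𝒮 i) (hb : b ∈ 𝒮 j)
    (hij : 12 < i + j) : a * b = 0 := by
  simpa [h𝒮 _ hij] using SetLike.mul_mem_graded ha hb

theorem HasComponents.mul (h𝒮 : ∀ k, 12 < k → 𝒮 k = ⊥) (ha : HasComponents 𝒮 a a₀ a₁ a₂ a₃)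
    (hb : HasComponents 𝒮 b b₀ b₁ b₂ b₃) :
    HasComponents 𝒮 (a * b) (a₀ * b₀) (a₀ * b₁ + a₁ * b₀) (a₀ * b₂ + a₁ * b₁ + a₂ * b₀)
      (a₀ * b₃ + a₁ * b₂ + a₂ * b₁ + a₃ * b₀) where
  mem₀ := mul_mem_of_add_eq ha.mem₀ hb.mem₀ rfl
  mem₁ := add_mem (mul_mem_of_add_eq ha.mem₀ hb.mem₁ rfl) (mul_mem_of_add_eq ha.mem₁ hb.mem₀ rfl)
  mem₂ := add_mem (add_mem (mul_mem_of_add_eq ha.mem₀ hb.mem₂ rfl)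
    (mul_mem_of_add_eq ha.mem₁ hb.mem₁ rfl)) (mul_mem_of_add_eq ha.mem₂ hb.mem₀ rfl)
  mem₃ := add_mem (add_mem (add_mem (mul_mem_of_add_eq ha.mem₀ hb.mem₃ rfl)
    (mul_mem_of_add_eq ha.mem₁ hb.mem₂ rfl)) (mul_mem_of_add_eq ha.mem₂ hb.mem₁ rfl))
    (mul_mem_of_add_eq ha.mem₃ hb.mem₀ rfl)
  eq_sum := by
    rw [ha.eq_sum, hb.eq_sum]
    linear_combination mul_eq_zero_of_mem h𝒮 ha.mem₁ hb.mem₃ (by norm_num)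
      + mul_eq_zero_of_mem h𝒮 ha.mem₂ hb.mem₂ (by norm_num)
      + mul_eq_zero_of_mem h𝒮 ha.mem₂ hb.mem₃ (by norm_num)
      + mul_eq_zero_of_mem h𝒮 ha.mem₃ hb.mem₁ (by norm_num)
      + mul_eq_zero_of_mem h𝒮 ha.mem₃ hb.mem₂ (by norm_num)
      + mul_eq_zero_of_mem h𝒮 ha.mem₃ hb.mem₃ (by norm_num)

theorem HasComponents.evalSeries_of_zero (h𝒮 : ∀ k, 12 < k → 𝒮 k = ⊥) (f : PowerSeries ℂ)
    (ha : HasComponents 𝒮 a 0 a₁ a₂ a₃) :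
    HasComponents 𝒮 (evalSeries f a) (PowerSeries.coeff 0 f • 1) (PowerSeries.coeff 1 f • a₁)
      (PowerSeries.coeff 1 f • a₂ + PowerSeries.coeff 2 f • a₁ ^ 2)
      (PowerSeries.coeff 1 f • a₃ + PowerSeries.coeff 2 f • (2 * (a₁ * a₂))
        + PowerSeries.coeff 3 f • a₁ ^ 3) := by
  have h2 := ha.mul h𝒮 ha
  have h3 := h2.mul h𝒮 ha
  have h4 := h3.mul h𝒮 ha
  have hnil : a ^ 4 = 0 := by
    have := h4.eq_sum
    simp only [zero_mul, mul_zero, add_zero] at this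
    rw [← this]; ring
  have h := (((HasComponents.one (𝒮 := 𝒮)).smul (PowerSeries.coeff 0 f)).add
    (ha.smul (PowerSeries.coeff 1 f))).add
    ((h2.smul (PowerSeries.coeff 2 f)).add (h3.smul (PowerSeries.coeff 3 f)))
  rw [evalSeries_eq_sum f hnil]
  convert h using 1
  · simp only [Finset.sum_range_succ, Finset.sum_range_zero, pow_zero, pow_one]
    ring_nf
  all_goals simp only [mul_zero, zero_mul, add_zero, zero_add, smul_zero]
  · rw [sq]
  · algebra

theorem hasComponents_evalSeries_of_even (h𝒮 : ∀ k, 12 < k → 𝒮 k = ⊥) (f : PowerSeries ℂ)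
    (h1 : PowerSeries.coeff 1 f = 0) (h3 : PowerSeries.coeff 3 f = 0)
    (h5 : PowerSeries.coeff 5 f = 0) (ha : a ∈ 𝒮 2) :
    HasComponents 𝒮 (evalSeries f a) (PowerSeries.coeff 0 f • 1) (PowerSeries.coeff 2 f • a ^ 2)
      (PowerSeries.coeff 4 f • a ^ 4) (PowerSeries.coeff 6 f • a ^ 6) where
  mem₀ := Submodule.smul_mem _ _ (SetLike.one_mem_graded 𝒮)
  mem₁ := Submodule.smul_mem _ _ (pow_mem_of_mul_eq ha rfl)
  mem₂ := Submodule.smul_mem _ _ (pow_mem_of_mul_eq ha rfl)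
  mem₃ := Submodule.smul_mem _ _ (pow_mem_of_mul_eq ha rfl)
  eq_sum := by
    have hnil : a ^ 7 = 0 := by
      have := pow_mem_of_mul_eq (𝒮 := 𝒮) (m := 7) (k := 14) ha rfl
      simpa [h𝒮 14 (by norm_num)] using this
    simp [evalSeries_eq_sum f hnil, Finset.sum_range_succ, h1, h3, h5]

/-! ### Square roots of determinants -/

section Matrix

variable {ι : Type*} [Fintype ι] [DecidableEq ι] {M : Matrix ι ι S}

theorem matrix_pow_apply_mem (hM : ∀ i j, M i j ∈ 𝒮 2) (k : ℕ) (i j : ι) :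
    (M ^ k) i j ∈ 𝒮 (2 * k) := by
  induction k generalizing i j with
  | zero =>
    rw [pow_zero, Matrix.one_apply]
    split_ifs
    exacts [SetLike.one_mem_graded 𝒮, zero_mem _]
  | succ k ih =>
    rw [pow_succ, Matrix.mul_apply]
    exact sum_mem fun m _ => mul_mem_of_add_eq (ih i m) (hM m j) rfl

theorem trace_pow_mem (hM : ∀ i j, M i j ∈ 𝒮 2) {k m : ℕ} (hm : 2 * k = m) :
    (M ^ k).trace ∈ 𝒮 m :=
  sum_mem fun i _ => hm ▸ matrix_pow_apply_mem hM k i i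

theorem matrix_pow_seven_eq_zero (h𝒮 : ∀ k, 12 < k → 𝒮 k = ⊥) (hM : ∀ i j, M i j ∈ 𝒮 2) :
    M ^ 7 = 0 := by
  ext i j
  simpa [h𝒮 14 (by norm_num)] using matrix_pow_apply_mem hM 7 i j

/-- For an even series `f = α (1 + b₂ z² + b₄ z⁴ + b₆ z⁶ + ⋯)`, the exponent `½ tr log (α⁻¹ f(M))`
is obtained from the series `½ log (α⁻¹ f)`, truncated after `z⁶`, by replacing `z^k` by
`tr M^k`. -/
theorem detSqrt_eq_exp_trace (h𝒮 : ∀ k, 12 < k → 𝒮 k = ⊥) (hM : ∀ i j, M i j ∈ 𝒮 2)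
    (f : PowerSeries ℂ) {α b₂ b₄ b₆ : ℂ} (hα : α ≠ 0) (h0 : PowerSeries.coeff 0 f = α)
    (h1 : PowerSeries.coeff 1 f = 0) (h2 : PowerSeries.coeff 2 f = α * b₂)
    (h3 : PowerSeries.coeff 3 f = 0) (h4 : PowerSeries.coeff 4 f = α * b₄)
    (h5 : PowerSeries.coeff 5 f = 0) (h6 : PowerSeries.coeff 6 f = α * b₆) :
    detSqrt f M = α ^ ((Fintype.card ι : ℂ) / 2) • evalSeries expSeries
      ((b₂ / 2) • (M ^ 2).trace + ((b₄ - b₂ ^ 2 / 2) / 2) • (M ^ 4).trace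
        + ((b₆ - b₂ * b₄ + b₂ ^ 3 / 3) / 2) • (M ^ 6).trace) := by
  have h7 := matrix_pow_seven_eq_zero h𝒮 hM
  have h8 : M ^ 8 = 0 := pow_eq_zero_of_le (by norm_num) h7
  have h10 : M ^ 10 = 0 := pow_eq_zero_of_le (by norm_num) h7
  have h12 : M ^ 12 = 0 := pow_eq_zero_of_le (by norm_num) h7
  set N : Matrix ι ι S := b₂ • M ^ 2 + b₄ • M ^ 4 + b₆ • M ^ 6 with hN
  have hfM : α⁻¹ • evalSeries f M - 1 = N := by
    rw [evalSeries_eq_sum f h7]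
    simp only [Finset.sum_range_succ, Finset.sum_range_zero, h0, h1, h2, h3, h4, h5, h6, zero_smul,
      pow_zero, smul_add, smul_smul, ← mul_assoc, inv_mul_cancel₀ hα, one_mul, zero_add, add_zero,
      one_smul]
    rw [hN]; abel
  have hN2 : N ^ 2 = (b₂ ^ 2) • M ^ 4 + (2 * b₂ * b₄) • M ^ 6 := by
    rw [sq, hN]
    simp only [mul_add, add_mul, smul_mul_smul_comm, ← pow_add]
    norm_num [h8, h10, h12]
    module
  have hN3 : N ^ 3 = (b₂ ^ 3) • M ^ 6 := by
    rw [pow_succ, hN2, hN]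
    simp only [mul_add, add_mul, smul_mul_smul_comm, ← pow_add]
    norm_num [h8, h10, h12]
    module
  have hN4 : N ^ 4 = 0 := by
    rw [pow_succ, hN3, hN]
    simp only [mul_add, smul_mul_smul_comm, ← pow_add]
    norm_num [h8, h10, h12]
  have hlog : evalSeries logOneAddSeries N = N - (1 / 2 : ℂ) • N ^ 2 + (1 / 3 : ℂ) • N ^ 3 := by
    rw [evalSeries_eq_sum _ hN4]
    simp only [Finset.sum_range_succ, Finset.sum_range_zero, logOneAddSeries, PowerSeries.coeff_mk]
    norm_num
    module
  have hα' : PowerSeries.constantCoeff f = α := by simpa using h0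
  simp only [detSqrt, hα', hfM, hlog, hN2, hN3]
  congr 2
  rw [hN]
  simp only [Matrix.trace_add, Matrix.trace_sub, Matrix.trace_smul]
  module

theorem hasComponents_detSqrt (h𝒮 : ∀ k, 12 < k → 𝒮 k = ⊥) (hM : ∀ i j, M i j ∈ 𝒮 2)
    (f : PowerSeries ℂ) {α b₂ b₄ b₆ : ℂ} (hα : α ≠ 0) (h0 : PowerSeries.coeff 0 f = α)
    (h1 : PowerSeries.coeff 1 f = 0) (h2 : PowerSeries.coeff 2 f = α * b₂)
    (h3 : PowerSeries.coeff 3 f = 0) (h4 : PowerSeries.coeff 4 f = α * b₄)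
    (h5 : PowerSeries.coeff 5 f = 0) (h6 : PowerSeries.coeff 6 f = α * b₆) {g₁ g₂ g₃ : S}
    (hg₁ : g₁ = (b₂ / 2) • (M ^ 2).trace) (hg₂ : g₂ = ((b₄ - b₂ ^ 2 / 2) / 2) • (M ^ 4).trace)
    (hg₃ : g₃ = ((b₆ - b₂ * b₄ + b₂ ^ 3 / 3) / 2) • (M ^ 6).trace) {r : ℂ}
    (hr : α ^ ((Fintype.card ι : ℂ) / 2) = r) :
    HasComponents 𝒮 (detSqrt f M) (r • 1) (r • g₁) (r • (g₂ + (1 / 2 : ℂ) • g₁ ^ 2))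
      (r • (g₃ + g₁ * g₂ + (1 / 6 : ℂ) • g₁ ^ 3)) := by
  rw [detSqrt_eq_exp_trace h𝒮 hM f hα h0 h1 h2 h3 h4 h5 h6, ← hg₁, ← hg₂, ← hg₃, hr]
  have hg : HasComponents 𝒮 (g₁ + g₂ + g₃) 0 g₁ g₂ g₃ :=
    { mem₀ := zero_mem _
      mem₁ := hg₁ ▸ Submodule.smul_mem _ _ (trace_pow_mem hM rfl)
      mem₂ := hg₂ ▸ Submodule.smul_mem _ _ (trace_pow_mem hM rfl)
      mem₃ := hg₃ ▸ Submodule.smul_mem _ _ (trace_pow_mem hM rfl)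
      eq_sum := by simp }
  convert (hg.evalSeries_of_zero h𝒮 expSeries).smul r using 2 <;>
    simp only [expSeries, PowerSeries.coeff_mk] <;> norm_num [Nat.factorial]
  algebra

end Matrix

end Graded

/-! ### Coefficients of the power series -/

/-- The first coefficients of `1 / (1 + b₂ z² + b₄ z⁴ + b₆ z⁶ + ⋯)`. -/
theorem coeff_inv_of_even (f : PowerSeries ℂ) {b₂ b₄ b₆ : ℂ} (h0 : PowerSeries.coeff 0 f = 1)
    (h1 : PowerSeries.coeff 1 f = 0) (h2 : PowerSeries.coeff 2 f = b₂)
    (h3 : PowerSeries.coeff 3 f = 0) (h4 : PowerSeries.coeff 4 f = b₄)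
    (h5 : PowerSeries.coeff 5 f = 0) (h6 : PowerSeries.coeff 6 f = b₆) :
    PowerSeries.coeff 0 f⁻¹ = 1 ∧ PowerSeries.coeff 1 f⁻¹ = 0 ∧ PowerSeries.coeff 2 f⁻¹ = -b₂ ∧
      PowerSeries.coeff 3 f⁻¹ = 0 ∧ PowerSeries.coeff 4 f⁻¹ = b₂ ^ 2 - b₄ ∧
      PowerSeries.coeff 5 f⁻¹ = 0 ∧ PowerSeries.coeff 6 f⁻¹ = -b₆ + 2 * b₂ * b₄ - b₂ ^ 3 := by
  have hc : PowerSeries.constantCoeff f = 1 := by simpa using h0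
  have g0 : PowerSeries.coeff 0 f⁻¹ = 1 := by rw [PowerSeries.coeff_inv]; simp [hc]
  have step : ∀ n, n ≠ 0 →
      ∑ k ∈ Finset.range (n + 1), PowerSeries.coeff k f * PowerSeries.coeff (n - k) f⁻¹ = 0 := by
    intro n hn
    have h := congrArg (PowerSeries.coeff n) (PowerSeries.mul_inv_cancel f (by simp [hc]))
    rwa [PowerSeries.coeff_mul, PowerSeries.coeff_one, if_neg hn,
      Finset.Nat.sum_antidiagonal_eq_sum_range_succ
        fun i j => PowerSeries.coeff i f * PowerSeries.coeff j f⁻¹] at h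
  have g1 : PowerSeries.coeff 1 f⁻¹ = 0 := by
    simpa [Finset.sum_range_succ, -PowerSeries.coeff_zero_eq_constantCoeff, h0, h1, g0]
      using step 1 (by norm_num)
  have g2 : PowerSeries.coeff 2 f⁻¹ = -b₂ := by
    have := step 2 (by norm_num)
    simp [Finset.sum_range_succ, -PowerSeries.coeff_zero_eq_constantCoeff, h0, h1, h2, g0, g1]
      at this
    linear_combination this
  have g3 : PowerSeries.coeff 3 f⁻¹ = 0 := by
    simpa [Finset.sum_range_succ, -PowerSeries.coeff_zero_eq_constantCoeff, h0, h1, h2, h3, g0, g1]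
      using step 3 (by norm_num)
  have g4 : PowerSeries.coeff 4 f⁻¹ = b₂ ^ 2 - b₄ := by
    have := step 4 (by norm_num)
    simp [Finset.sum_range_succ, -PowerSeries.coeff_zero_eq_constantCoeff, h0, h1, h2, h3, h4, g0,
      g1, g2, g3] at this
    linear_combination this
  have g5 : PowerSeries.coeff 5 f⁻¹ = 0 := by
    simpa [Finset.sum_range_succ, -PowerSeries.coeff_zero_eq_constantCoeff, h0, h1, h2, h3, h4, h5,
      g0, g1, g2, g3, g4] using step 5 (by norm_num)
  refine ⟨g0, g1, g2, g3, g4, g5, ?_⟩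
  have := step 6 (by norm_num)
  simp [Finset.sum_range_succ, -PowerSeries.coeff_zero_eq_constantCoeff, h0, h1, h2, h3, h4, h5, h6,
    g0, g1, g2, g3, g4, g5] at this
  linear_combination this

theorem coeff_expSeries :
    PowerSeries.coeff 0 expSeries = 1 ∧ PowerSeries.coeff 1 expSeries = 1 ∧
      PowerSeries.coeff 2 expSeries = 1 / 2 ∧ PowerSeries.coeff 3 expSeries = 1 / 6 ∧
      PowerSeries.coeff 4 expSeries = 1 / 24 ∧ PowerSeries.coeff 5 expSeries = 1 / 120 ∧
      PowerSeries.coeff 6 expSeries = 1 / 720 := by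
  simp only [expSeries, PowerSeries.coeff_mk]
  norm_num [Nat.factorial]

theorem coeff_coshSeries :
    PowerSeries.coeff 0 coshSeries = 1 ∧ PowerSeries.coeff 1 coshSeries = 0 ∧
      PowerSeries.coeff 2 coshSeries = 1 / 2 ∧ PowerSeries.coeff 3 coshSeries = 0 ∧
      PowerSeries.coeff 4 coshSeries = 1 / 24 ∧ PowerSeries.coeff 5 coshSeries = 0 ∧
      PowerSeries.coeff 6 coshSeries = 1 / 720 := by
  simp only [coshSeries, PowerSeries.coeff_mk]
  norm_num [Nat.factorial, Nat.even_iff]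

theorem coeff_sinhDivSeries_inv :
    PowerSeries.coeff 0 sinhDivSeries⁻¹ = 1 ∧ PowerSeries.coeff 1 sinhDivSeries⁻¹ = 0 ∧
      PowerSeries.coeff 2 sinhDivSeries⁻¹ = -1 / 6 ∧ PowerSeries.coeff 3 sinhDivSeries⁻¹ = 0 ∧
      PowerSeries.coeff 4 sinhDivSeries⁻¹ = 7 / 360 ∧ PowerSeries.coeff 5 sinhDivSeries⁻¹ = 0 ∧
      PowerSeries.coeff 6 sinhDivSeries⁻¹ = -31 / 15120 := by
  have h := coeff_inv_of_even sinhDivSeries (b₂ := 1 / 6) (b₄ := 1 / 120) (b₆ := 1 / 5040)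
  norm_num only at h ⊢
  refine h ?_ ?_ ?_ ?_ ?_ ?_ ?_
  all_goals
    rw [sinhDivSeries, PowerSeries.coeff_mk]
    norm_num [Nat.factorial, Nat.even_iff]

theorem coeff_coshSeries_sq_inv :
    PowerSeries.coeff 0 (coshSeries ^ 2)⁻¹ = 1 ∧ PowerSeries.coeff 1 (coshSeries ^ 2)⁻¹ = 0 ∧
      PowerSeries.coeff 2 (coshSeries ^ 2)⁻¹ = -1 ∧ PowerSeries.coeff 3 (coshSeries ^ 2)⁻¹ = 0 ∧
      PowerSeries.coeff 4 (coshSeries ^ 2)⁻¹ = 2 / 3 ∧ PowerSeries.coeff 5 (coshSeries ^ 2)⁻¹ = 0 ∧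
      PowerSeries.coeff 6 (coshSeries ^ 2)⁻¹ = -17 / 45 := by
  obtain ⟨f0, f1, f2, f3, f4, f5, f6⟩ := coeff_coshSeries
  have hsq : ∀ n, PowerSeries.coeff n (coshSeries ^ 2) =
      ∑ k ∈ Finset.range (n + 1),
        PowerSeries.coeff k coshSeries * PowerSeries.coeff (n - k) coshSeries := fun n => by
    rw [sq, PowerSeries.coeff_mul, Finset.Nat.sum_antidiagonal_eq_sum_range_succ
        fun i j => PowerSeries.coeff i coshSeries * PowerSeries.coeff j coshSeries]
  have h := coeff_inv_of_even (coshSeries ^ 2) (b₂ := 1) (b₄ := 1 / 3) (b₆ := 2 / 45)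
  norm_num only at h ⊢
  refine h ?_ ?_ ?_ ?_ ?_ ?_ ?_
  all_goals
    rw [hsq]
    norm_num [Finset.sum_range_succ, -PowerSeries.coeff_zero_eq_constantCoeff, f0, f1, f2, f3, f4,
      f5, f6]

/-! ### Components of the characteristic forms -/

section Graded

variable {S : Type*} [CommRing S] [Algebra ℂ S] {𝒮 : ℕ → Submodule ℂ S} [SetLike.GradedMonoid 𝒮]
  {ι : Type*} [Fintype ι] [DecidableEq ι] {M : Matrix ι ι S} {c p : S}

/-- `det^{1/2}(M / sinh M) = exp (g₁ + g₂ + g₃)`. -/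
theorem hasComponents_detSqrt_sinhDivSeries_inv (h𝒮 : ∀ k, 12 < k → 𝒮 k = ⊥)
    (hM : ∀ i j, M i j ∈ 𝒮 2) {g₁ g₂ g₃ : S} (hg₁ : g₁ = (-1 / 12 : ℂ) • (M ^ 2).trace)
    (hg₂ : g₂ = (1 / 360 : ℂ) • (M ^ 4).trace) (hg₃ : g₃ = (-1 / 5670 : ℂ) • (M ^ 6).trace) :
    HasComponents 𝒮 (detSqrt sinhDivSeries⁻¹ M) ((1 : ℂ) • 1) ((1 : ℂ) • g₁)
      ((1 : ℂ) • (g₂ + (1 / 2 : ℂ) • g₁ ^ 2))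
      ((1 : ℂ) • (g₃ + g₁ * g₂ + (1 / 6 : ℂ) • g₁ ^ 3)) := by
  obtain ⟨h0, h1, h2, h3, h4, h5, h6⟩ := coeff_sinhDivSeries_inv
  refine hasComponents_detSqrt h𝒮 hM _ one_ne_zero h0 h1 (h2.trans (one_mul _).symm) h3
    (h4.trans (one_mul _).symm) h5 (h6.trans (one_mul _).symm) ?_ ?_ ?_ (Complex.one_cpow _)
  · rw [hg₁]; norm_num
  · rw [hg₂]; norm_num
  · rw [hg₃]; norm_num

/-- `det^{1/2}(2 cosh M) = 2^l exp (g₁ + g₂ + g₃)`. -/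
theorem hasComponents_detSqrt_two_smul_coshSeries (h𝒮 : ∀ k, 12 < k → 𝒮 k = ⊥)
    (hM : ∀ i j, M i j ∈ 𝒮 2) {l : ℕ} (hl : Fintype.card ι = 2 * l) {g₁ g₂ g₃ : S}
    (hg₁ : g₁ = (1 / 4 : ℂ) • (M ^ 2).trace) (hg₂ : g₂ = (-1 / 24 : ℂ) • (M ^ 4).trace)
    (hg₃ : g₃ = (1 / 90 : ℂ) • (M ^ 6).trace) :
    HasComponents 𝒮 (detSqrt ((2 : ℂ) • coshSeries) M) ((2 ^ l : ℂ) • 1) ((2 ^ l : ℂ) • g₁)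
      ((2 ^ l : ℂ) • (g₂ + (1 / 2 : ℂ) • g₁ ^ 2))
      ((2 ^ l : ℂ) • (g₃ + g₁ * g₂ + (1 / 6 : ℂ) • g₁ ^ 3)) := by
  have hcoeff : ∀ k, PowerSeries.coeff k ((2 : ℂ) • coshSeries) =
      2 * if Even k then ((k.factorial : ℂ))⁻¹ else 0 := fun k => by
    simp [coshSeries]
  refine hasComponents_detSqrt h𝒮 hM ((2 : ℂ) • coshSeries) (α := 2) (b₂ := 1 / 2) (b₄ := 1 / 24)
    (b₆ := 1 / 720) two_ne_zero ?_ ?_ ?_ ?_ ?_ ?_ ?_ ?_ ?_ ?_ ?_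
  case refine_11 =>
    rw [hl, Nat.cast_mul, Nat.cast_two, mul_div_cancel_left₀ _ two_ne_zero, Complex.cpow_natCast]
  case refine_8 => rw [hg₁]; norm_num
  case refine_9 => rw [hg₂]; norm_num
  case refine_10 => rw [hg₃]; norm_num
  all_goals rw [hcoeff]; norm_num [Nat.factorial, Nat.even_iff]

theorem hasComponents_evalSeries_coshSeries (h𝒮 : ∀ k, 12 < k → 𝒮 k = ⊥) (hc : c ∈ 𝒮 2) :
    HasComponents 𝒮 (evalSeries coshSeries ((1 / 2 : ℂ) • c)) 1 ((1 / 8 : ℂ) • c ^ 2)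
      ((1 / 384 : ℂ) • c ^ 4) ((1 / 46080 : ℂ) • c ^ 6) := by
  obtain ⟨h0, h1, h2, h3, h4, h5, h6⟩ := coeff_coshSeries
  convert hasComponents_evalSeries_of_even h𝒮 coshSeries h1 h3 h5
    (Submodule.smul_mem _ (1 / 2 : ℂ) hc) using 1
  all_goals
    simp only [h0, h2, h4, h6]
    algebra

theorem hasComponents_evalSeries_coshSeries_sq_inv (h𝒮 : ∀ k, 12 < k → 𝒮 k = ⊥) (hc : c ∈ 𝒮 2) :
    HasComponents 𝒮 (evalSeries (coshSeries ^ 2)⁻¹ ((1 / 2 : ℂ) • c)) 1 ((-1 / 4 : ℂ) • c ^ 2)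
      ((1 / 24 : ℂ) • c ^ 4) ((-17 / 2880 : ℂ) • c ^ 6) := by
  obtain ⟨h0, h1, h2, h3, h4, h5, h6⟩ := coeff_coshSeries_sq_inv
  convert hasComponents_evalSeries_of_even h𝒮 (coshSeries ^ 2)⁻¹ h1 h3 h5
    (Submodule.smul_mem _ (1 / 2 : ℂ) hc) using 1
  all_goals
    simp only [h0, h2, h4, h6]
    algebra

theorem hasComponents_exp_add_exp_neg_sub_two (h𝒮 : ∀ k, 12 < k → 𝒮 k = ⊥) (hc : c ∈ 𝒮 2) :
    HasComponents 𝒮 (evalSeries expSeries c + evalSeries expSeries (-c) - 2) 0 (c ^ 2)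
      ((1 / 12 : ℂ) • c ^ 4) ((1 / 360 : ℂ) • c ^ 6) where
  mem₀ := zero_mem _
  mem₁ := pow_mem_of_mul_eq hc rfl
  mem₂ := Submodule.smul_mem _ _ (pow_mem_of_mul_eq hc rfl)
  mem₃ := Submodule.smul_mem _ _ (pow_mem_of_mul_eq hc rfl)
  eq_sum := by
    have hnil : c ^ 7 = 0 := by
      have := pow_mem_of_mul_eq (𝒮 := 𝒮) (m := 7) (k := 14) hc rfl
      simpa [h𝒮 14 (by norm_num)] using this
    have hnil' : (-c) ^ 7 = 0 := by rw [Odd.neg_pow (by decide), hnil, neg_zero]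
    rw [evalSeries_eq_sum _ hnil, evalSeries_eq_sum _ hnil']
    obtain ⟨h0, h1, h2, h3, h4, h5, h6⟩ := coeff_expSeries
    simp only [Finset.sum_range_succ, Finset.sum_range_zero, h0, h1, h2, h3, h4, h5, h6]
    algebra

theorem hasComponents_evalSeries_of_mem_four (h𝒮 : ∀ k, 12 < k → 𝒮 k = ⊥) (f : PowerSeries ℂ)
    (hp : p ∈ 𝒮 4) :
    HasComponents 𝒮 (evalSeries f p) (PowerSeries.coeff 0 f • 1) (PowerSeries.coeff 1 f • p)
      (PowerSeries.coeff 2 f • p ^ 2) (PowerSeries.coeff 3 f • p ^ 3) := by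
  simpa using HasComponents.evalSeries_of_zero h𝒮 f
    (show HasComponents 𝒮 p 0 p 0 0 from ⟨zero_mem _, hp, zero_mem _, zero_mem _, by simp⟩)

/-- `tr exp(2M)`, split into the components in degrees `0, 4, 8, 12` and those in degrees
`2, 6, 10`. The latter are the traces of odd powers of `M`. -/
theorem exists_trace_exp_eq_add (h𝒮 : ∀ k, 12 < k → 𝒮 k = ⊥) (hM : ∀ i j, M i j ∈ 𝒮 2) :
    ∃ e r₂ r₆ r₁₀ : S, (evalSeries expSeries ((2 : ℂ) • M)).trace = e + (r₂ + r₆ + r₁₀) ∧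
      r₂ ∈ 𝒮 2 ∧ r₆ ∈ 𝒮 6 ∧ r₁₀ ∈ 𝒮 10 ∧
      HasComponents 𝒮 e ((Fintype.card ι : ℂ) • 1) ((2 : ℂ) • (M ^ 2).trace)
        ((2 / 3 : ℂ) • (M ^ 4).trace) ((4 / 45 : ℂ) • (M ^ 6).trace) := by
  refine ⟨_, (2 : ℂ) • (M ^ 1).trace, (4 / 3 : ℂ) • (M ^ 3).trace, (4 / 15 : ℂ) • (M ^ 5).trace, ?_,
    Submodule.smul_mem _ _ (trace_pow_mem hM rfl), Submodule.smul_mem _ _ (trace_pow_mem hM rfl),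
    Submodule.smul_mem _ _ (trace_pow_mem hM rfl),
    Submodule.smul_mem _ _ (SetLike.one_mem_graded 𝒮),
    Submodule.smul_mem _ _ (trace_pow_mem hM rfl), Submodule.smul_mem _ _ (trace_pow_mem hM rfl),
    Submodule.smul_mem _ _ (trace_pow_mem hM rfl), rfl⟩
  have hnil : ((2 : ℂ) • M) ^ 7 = 0 := by
    rw [smul_pow, matrix_pow_seven_eq_zero h𝒮 hM, smul_zero]
  rw [evalSeries_eq_sum _ hnil]
  obtain ⟨h0, h1, h2, h3, h4, h5, h6⟩ := coeff_expSeries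
  have hcard : (Fintype.card ι : S) = (Fintype.card ι : ℂ) • (1 : S) := by
    simp [Algebra.smul_def]
  simp only [Finset.sum_range_succ, Finset.sum_range_zero, h0, h1, h2, h3, h4, h5, h6,
    Matrix.trace_add, Matrix.trace_smul, smul_pow, pow_zero, Matrix.trace_one, Matrix.trace_zero,
    hcard]
  -- the powers of `M` must be opaque for `algebra`, which otherwise tries to unify them
  generalize (M ^ 1).trace = t₁, (M ^ 2).trace = t₂, (M ^ 3).trace = t₃, (M ^ 4).trace = t₄,
    (M ^ 5).trace = t₅, (M ^ 6).trace = t₆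
  algebra

/-- Comparison of the components. The letters stand for `Â`, `det^{1/2}(2 cosh)`, `P = e^{p/24}`,
`Q = (e^{p/24} - 1) / p`, `C = cosh (c/2)`, `T = 1 / cosh² (c/2)`, `E = e^c + e^{-c} - 2`, and `e`
is the part of `ch(W_ℂ)` in degrees `0, 4, 8, 12`. The factor `P A = e^{p/24} Â` has components
`1, -w₁/12, …` in which `x₁` no longer occurs; the components in degrees `8` and `12`, where the
higher Pontryagin forms of the tangent bundle enter, are only ever multiplied by vanishing
components of the other factor. -/
theorem exists_hasComponents_anomaly (h𝒮 : ∀ k, 12 < k → 𝒮 k = ⊥)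
    {A D P Q C T E e x₁ w₁ w₂ w₃ a₂ a₃ p₂ p₃ q₁ q₂ q₃ : S} {L l : ℂ}
    (hA : HasComponents 𝒮 A 1 ((-1 / 12 : ℂ) • x₁) a₂ a₃)
    (hD : HasComponents 𝒮 D (L • 1) (L • ((1 / 4 : ℂ) • w₁))
      (L • ((-1 / 24 : ℂ) • w₂ + (1 / 32 : ℂ) • w₁ ^ 2))
      (L • ((1 / 90 : ℂ) • w₃ - (1 / 96 : ℂ) • (w₁ * w₂) + (1 / 384 : ℂ) • w₁ ^ 3)))
    (hP : HasComponents 𝒮 P 1 ((1 / 12 : ℂ) • (x₁ - w₁)) p₂ p₃)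
    (hQ : HasComponents 𝒮 Q ((1 / 24 : ℂ) • 1) q₁ q₂ q₃)
    (hC : HasComponents 𝒮 C 1 ((1 / 8 : ℂ) • c ^ 2) ((1 / 384 : ℂ) • c ^ 4)
      ((1 / 46080 : ℂ) • c ^ 6))
    (hT : HasComponents 𝒮 T 1 ((-1 / 4 : ℂ) • c ^ 2) ((1 / 24 : ℂ) • c ^ 4)
      ((-17 / 2880 : ℂ) • c ^ 6))
    (hE : HasComponents 𝒮 E 0 (c ^ 2) ((1 / 12 : ℂ) • c ^ 4) ((1 / 360 : ℂ) • c ^ 6))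
    (he : HasComponents 𝒮 e ((2 * l) • 1) ((2 : ℂ) • w₁) ((2 / 3 : ℂ) • w₂)
      ((4 / 45 : ℂ) • w₃)) :
    (∃ b₁ b₂ b₃, HasComponents 𝒮 (Q * (A * D * T + (2 * L) • (A * C))) ((L / 8) • 1) b₁ b₂ b₃) ∧
    (∃ b₀ b₂ b₃, HasComponents 𝒮 (P * (A * D * T + (2 * L) • (A * C))) b₀ 0 b₂ b₃) ∧
    (∃ b₀ b₁ b₃, HasComponents 𝒮 (P * (A * D * T - A * C * ((-(L / 16)) • e
      + (L / 8 * (l + 8)) • (1 : S) + (3 * (L / 16)) • E))) b₀ b₁ 0 b₃) ∧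
    (∃ b₀ b₁ b₂, HasComponents 𝒮 (P * (A * D * T - A * C * ((L / 8) • e
      - (L / 4 * (l - 4)) • (1 : S) - (3 * (L / 8)) • E))) b₀ b₁ b₂ 0) := by
  have h1 := HasComponents.one (𝒮 := 𝒮)
  have hDT := hD.mul h𝒮 hT
  have hPA := (hP.mul h𝒮 hA).congr (b₀ := 1) (b₁ := (-1 / 12 : ℂ) • w₁) (by algebra) (by algebra)
    rfl rfl
  have hQA := (hQ.mul h𝒮 hA).congr (b₀ := (1 / 24 : ℂ) • 1) (by algebra) rfl rfl rfl
  have h4 := (hDT.add (hC.smul (2 * L))).congr (b₀ := (3 * L) • 1)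
    (b₁ := (L / 4) • w₁) (by algebra) (by algebra) rfl rfl
  have hK8 := ((he.smul (-(L / 16))).add (h1.smul (L / 8 * (l + 8)))).add (hE.smul (3 * (L / 16)))
  have h8 := (hDT.sub (hC.mul h𝒮 hK8)).congr (b₀ := 0)
    (b₁ := (L * 3 / 8) • (w₁ - (3 / 2 : ℂ) • c ^ 2)) (by algebra) (by algebra) rfl rfl
  have hK12 := ((he.smul (L / 8)).sub (h1.smul (L / 4 * (l - 4)))).sub (hE.smul (3 * (L / 8)))
  have h12 := (hDT.sub (hC.mul h𝒮 hK12)).congr (b₀ := 0) (b₁ := 0) (by algebra) (by algebra)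
    rfl rfl
  -- in each case split off the factor `P A` or `Q A`
  have e4 : ∀ Z : S,
      Z * (A * D * T + (2 * L) • (A * C)) = Z * A * (D * T + (2 * L) • C) := fun Z => by algebra
  have e8 : ∀ K : S, P * (A * D * T - A * C * K) = P * A * (D * T - C * K) := fun K => by ring
  simp only [e4, e8]
  refine ⟨⟨_, _, _, (hQA.mul h𝒮 h4).congr ?_ rfl rfl rfl⟩,
    ⟨_, _, _, (hPA.mul h𝒮 h4).congr rfl ?_ rfl rfl⟩,
    ⟨_, _, _, (hPA.mul h𝒮 h8).congr rfl rfl ?_ rfl⟩,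
    ⟨_, _, _, (hPA.mul h𝒮 h12).congr rfl rfl rfl ?_⟩⟩
  all_goals algebra

end Graded

/-! ### Central forms and degrees -/

section Forms

variable {T : Type*} [AddCommGroup T] [Module ℝ T]

/-- Two-forms commute with all forms. -/
theorem exteriorPower_two_le_center :
    ⋀[ℂ]^2 (T →ₗ[ℝ] ℂ) ≤ Subalgebra.toSubmodule (Subalgebra.center ℂ (Form T)) := by
  rw [← ExteriorAlgebra.ιMulti_span_fixedDegree, Submodule.span_le]
  rintro _ ⟨v, rfl⟩
  simp only [SetLike.mem_coe, Subalgebra.mem_toSubmodule, Subalgebra.mem_center_iff]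
  have hswap : ∀ u w : T →ₗ[ℝ] ℂ, ExteriorAlgebra.ι ℂ u * ExteriorAlgebra.ι ℂ w
      = -(ExteriorAlgebra.ι ℂ w * ExteriorAlgebra.ι ℂ u) := fun u w =>
    eq_neg_of_add_eq_zero_left (ExteriorAlgebra.ι_add_mul_swap u w)
  intro η
  have hv : ExteriorAlgebra.ιMulti ℂ 2 v =
      ExteriorAlgebra.ι ℂ (v 0) * ExteriorAlgebra.ι ℂ (v 1) := by
    simp [ExteriorAlgebra.ιMulti_apply, Matrix.vecTail]
  rw [hv]
  induction η using ExteriorAlgebra.induction with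
  | algebraMap r => exact Algebra.commutes r _
  | ι u =>
    rw [← mul_assoc, hswap u, neg_mul, mul_assoc, hswap u, mul_neg, neg_neg, mul_assoc]
  | mul a b ha hb => rw [mul_assoc, hb, ← mul_assoc, ha, mul_assoc]
  | add a b ha hb => rw [add_mul, mul_add, ha, hb]

theorem exteriorPower_eq_bot_of_finrank_lt [FiniteDimensional ℝ T] {k : ℕ}
    (hk : Module.finrank ℝ T < k) : ⋀[ℂ]^k (T →ₗ[ℝ] ℂ) = ⊥ := by
  rw [← ExteriorAlgebra.ιMulti_span_fixedDegree, Submodule.span_eq_bot]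
  rintro _ ⟨v, rfl⟩
  refine AlternatingMap.map_linearDependent _ _ fun hv => ?_
  have := hv.fintype_card_le_finrank
  rw [Fintype.card_fin, Module.finrank_linearMap_self] at this
  omega

theorem twoForm_mem [FiniteDimensional ℝ T] (η : T → T → ℝ) :
    twoForm η ∈ ⋀[ℂ]^2 (T →ₗ[ℝ] ℂ) := by
  refine sum_mem fun i _ => sum_mem fun j _ => Submodule.smul_mem _ _ ?_
  have h : dualForm (Module.finBasis ℝ T) i * dualForm (Module.finBasis ℝ T) j ∈
      LinearMap.range (ExteriorAlgebra.ι ℂ) * LinearMap.range (ExteriorAlgebra.ι ℂ) :=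
    Submodule.mul_mem_mul (LinearMap.mem_range_self _ _) (LinearMap.mem_range_self _ _)
  rwa [← pow_two] at h

theorem degreePart_of_mem {i : ℕ} {η : Form T} (h : η ∈ ⋀[ℂ]^i (T →ₗ[ℝ] ℂ)) (j : ℕ) :
    degreePart j η = if i = j then η else 0 := by
  rw [degreePart, GradedRing.proj_apply]
  split_ifs with hij
  · subst hij
    exact DirectSum.decompose_of_mem_same _ h
  · exact DirectSum.decompose_of_mem_ne _ h hij

theorem degreePart_add (j : ℕ) (η θ : Form T) :
    degreePart j (η + θ) = degreePart j η + degreePart j θ := map_add _ _ _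

theorem degreePart_sub (j : ℕ) (η θ : Form T) :
    degreePart j (η - θ) = degreePart j η - degreePart j θ := map_sub _ _ _

theorem degreePart_smul (j : ℕ) (z : ℂ) (η : Form T) :
    degreePart j (z • η) = z • degreePart j η := by
  simp only [degreePart, GradedRing.proj_apply, DirectSum.decompose_smul]
  rfl

theorem degreePart_add_mul {i : ℕ} {p : Form T} (hp : p ∈ ⋀[ℂ]^i (T →ₗ[ℝ] ℂ)) (j : ℕ)
    (η : Form T) : degreePart (i + j) (p * η) = p * degreePart j η := by
  simp only [degreePart, GradedRing.proj_apply]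
  exact DirectSum.coe_decompose_mul_add_of_left_mem _ hp

variable (T) in
/-- The central forms. All forms in the statement are built from two-forms and therefore come from
this commutative ring. It is a type synonym of the centre whose only ring structure is the
commutative one. -/
def CentralForm : Type _ := Subalgebra.center ℂ (Form T)

noncomputable instance : CommRing (CentralForm T) :=
  inferInstanceAs (CommRing (Subalgebra.center ℂ (Form T)))

noncomputable instance : Algebra ℂ (CentralForm T) :=
  inferInstanceAs (Algebra ℂ (Subalgebra.center ℂ (Form T)))

variable (T) in
/-- The inclusion of the central forms into all forms. -/
noncomputable def CentralForm.val : CentralForm T →ₐ[ℂ] Form T :=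
  (Subalgebra.center ℂ (Form T)).val

theorem CentralForm.val_injective : Function.Injective (CentralForm.val T) :=
  Subtype.val_injective

theorem CentralForm.val_mul_comm (s : CentralForm T) (η : Form T) :
    CentralForm.val T s * η = η * CentralForm.val T s :=
  (Subalgebra.mem_center_iff.1 s.2 η).symm

variable (T) in
/-- The central forms which are homogeneous of degree `k`. -/
noncomputable def centralPart (k : ℕ) : Submodule ℂ (CentralForm T) :=
  (⋀[ℂ]^k (T →ₗ[ℝ] ℂ)).comap (CentralForm.val T).toLinearMap

theorem mem_centralPart {k : ℕ} {s : CentralForm T} :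
    s ∈ centralPart T k ↔ CentralForm.val T s ∈ ⋀[ℂ]^k (T →ₗ[ℝ] ℂ) := Iff.rfl

instance : SetLike.GradedMonoid (centralPart T) where
  one_mem := SetLike.one_mem_graded fun i : ℕ => ⋀[ℂ]^i (T →ₗ[ℝ] ℂ)
  mul_mem _ _ _ _ h h' :=
    SetLike.mul_mem_graded (A := fun i : ℕ => ⋀[ℂ]^i (T →ₗ[ℝ] ℂ)) h h'

theorem centralPart_eq_bot [FiniteDimensional ℝ T] {k : ℕ} (hk : Module.finrank ℝ T < k) :
    centralPart T k = ⊥ := by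
  refine (Submodule.eq_bot_iff _).2 fun s hs => CentralForm.val_injective ?_
  rw [mem_centralPart, exteriorPower_eq_bot_of_finrank_lt hk] at hs
  simpa using hs

theorem HasComponents.degreePart_eq {a a₀ a₁ a₂ a₃ : CentralForm T}
    (h : HasComponents (centralPart T) a a₀ a₁ a₂ a₃) :
    degreePart 0 (CentralForm.val T a) = CentralForm.val T a₀ ∧
      degreePart 4 (CentralForm.val T a) = CentralForm.val T a₁ ∧
      degreePart 8 (CentralForm.val T a) = CentralForm.val T a₂ ∧
      degreePart 12 (CentralForm.val T a) = CentralForm.val T a₃ := by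
  have h₀ := degreePart_of_mem (mem_centralPart.1 h.mem₀)
  have h₁ := degreePart_of_mem (mem_centralPart.1 h.mem₁)
  have h₂ := degreePart_of_mem (mem_centralPart.1 h.mem₂)
  have h₃ := degreePart_of_mem (mem_centralPart.1 h.mem₃)
  rw [h.eq_sum]
  simp [degreePart_add, h₀, h₁, h₂, h₃]

/-- A form of degree `2` mod `4` times a form with components in degrees `0, 4, 8, 12` only has
components in degrees `2` mod `4`. -/
theorem HasComponents.degreePart_mul_eq_zero {a a₀ a₁ a₂ a₃ r : CentralForm T}
    (h : HasComponents (centralPart T) a a₀ a₁ a₂ a₃) {k j : ℕ} (hr : r ∈ centralPart T k)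
    (hk : k % 4 = 2) (hj : j % 4 = 0) : degreePart j (CentralForm.val T (a * r)) = 0 := by
  have key : ∀ {i : ℕ} {b : CentralForm T}, b ∈ centralPart T i → i % 4 = 0 →
      degreePart j (CentralForm.val T (b * r)) = 0 := by
    intro i b hb hi
    rw [degreePart_of_mem (mem_centralPart.1 (mul_mem_of_add_eq hb hr rfl)), if_neg (by omega)]
  rw [h.eq_sum]
  simp only [add_mul, map_add, degreePart_add, key h.mem₀ rfl, key h.mem₁ rfl, key h.mem₂ rfl,
    key h.mem₃ rfl, add_zero]

theorem exists_val_eq {c : Form T} (hc : c ∈ ⋀[ℂ]^2 (T →ₗ[ℝ] ℂ)) :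
    ∃ c₀ ∈ centralPart T 2, c = CentralForm.val T c₀ :=
  ⟨⟨c, exteriorPower_two_le_center hc⟩, hc, rfl⟩

theorem exists_mapMatrix_val_eq {ι : Type*} [Fintype ι] [DecidableEq ι] {R : Matrix ι ι (Form T)}
    (hR : ∀ i j, R i j ∈ ⋀[ℂ]^2 (T →ₗ[ℝ] ℂ)) :
    ∃ R₀ : Matrix ι ι (CentralForm T), (∀ i j, R₀ i j ∈ centralPart T 2) ∧
      R = (CentralForm.val T).mapMatrix R₀ :=
  ⟨Matrix.of fun i j => ⟨R i j, exteriorPower_two_le_center (hR i j)⟩, hR, rfl⟩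

theorem mul_evalSeries_comm (f : PowerSeries ℂ) {c : Form T} (hc : c ∈ ⋀[ℂ]^2 (T →ₗ[ℝ] ℂ))
    (η : Form T) : η * evalSeries f c = evalSeries f c * η := by
  obtain ⟨c, -, rfl⟩ := exists_val_eq hc
  rw [← map_evalSeries CentralForm.val_injective, CentralForm.val_mul_comm]

end Forms

/-- `exp (p / 24) = 1 + p (exp (p / 24) - 1) / p`. -/
theorem evalSeries_exp_eq_one_add_mul {A : Type*} [Ring A] [Algebra ℂ A] {p : A} {N : ℕ}
    (hp : p ^ N = 0) :
    evalSeries expSeries ((1 / 24 : ℂ) • p) = 1 + p * evalSeries expSubOneDivSeries p := by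
  have hp' : ((1 / 24 : ℂ) • p) ^ (N + 1) = 0 := by
    rw [smul_pow, pow_succ p, hp, zero_mul, smul_zero]
  rw [evalSeries_eq_sum _ hp', evalSeries_eq_sum _ hp, Finset.sum_range_succ', Finset.mul_sum,
    add_comm]
  congr 1
  · simp [expSeries]
  · refine Finset.sum_congr rfl fun k _ => ?_
    rw [smul_pow, smul_smul, mul_smul_comm, ← pow_succ', expSeries, expSubOneDivSeries,
      PowerSeries.coeff_mk, PowerSeries.coeff_mk, mul_comm, ← div_eq_mul_inv]

/-! ### The identities for matrices of two-forms -/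

section Forms

variable {T : Type*} [AddCommGroup T] [Module ℝ T]

/-- The vanishing statements, for matrices `R` and `R'` of two-forms in place of the curvatures of
`TX` and `W`, and a two-form `c` in place of the Euler form. The first equation gives the constant
term that occurs in the identity of degree `4`. -/
theorem degreePart_anomaly [FiniteDimensional ℝ T] (hT : Module.finrank ℝ T ≤ 12) {ι κ : Type*}
    [Fintype ι] [DecidableEq ι] [Fintype κ] [DecidableEq κ] {l : ℕ}
    (hl : Fintype.card κ = 2 * l) {R : Matrix ι ι (Form T)}
    (hR : ∀ i j, R i j ∈ ⋀[ℂ]^2 (T →ₗ[ℝ] ℂ)) {R' : Matrix κ κ (Form T)}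
    (hR' : ∀ i j, R' i j ∈ ⋀[ℂ]^2 (T →ₗ[ℝ] ℂ)) {c : Form T} (hc : c ∈ ⋀[ℂ]^2 (T →ₗ[ℝ] ℂ))
    {A D ch p C S E Q P : Form T} {L : ℂ}
    (hA : A = detSqrt sinhDivSeries⁻¹ ((Complex.I / (4 * Real.pi)) • R))
    (hD : D = detSqrt ((2 : ℂ) • coshSeries) ((Complex.I / (4 * Real.pi)) • R'))
    (hch : ch = (evalSeries expSeries ((Complex.I / (2 * Real.pi)) • R')).trace)
    (hp : p = (-(1 / (8 * (Real.pi : ℂ) ^ 2))) • (R ^ 2).trace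
      - (-(1 / (8 * (Real.pi : ℂ) ^ 2))) • (R' ^ 2).trace)
    (hC : C = evalSeries coshSeries ((1 / 2 : ℂ) • c))
    (hS : S = evalSeries (coshSeries ^ 2)⁻¹ ((1 / 2 : ℂ) • c))
    (hE : E = evalSeries expSeries c + evalSeries expSeries (-c) - 2)
    (hQ : Q = evalSeries expSubOneDivSeries p)
    (hP : P = evalSeries expSeries ((1 / 24 : ℂ) • p)) (hL : L = 2 ^ l) :
    degreePart 0 (Q * (A * D * S + (2 * L) • (A * C))) = (L / 8) • 1 ∧
    degreePart 4 (P * (A * D * S + (2 * L) • (A * C))) = 0 ∧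
    degreePart 8 (P * (A * D * S - A * C * ((-(L / 16)) • ch
      + (L / 8 * (l + 8)) • (1 : Form T) + (3 * (L / 16)) • E))) = 0 ∧
    degreePart 12 (P * (A * D * S - A * C * ((L / 8) • ch
      - (L / 4 * (l - 4)) • (1 : Form T) - (3 * (L / 8)) • E))) = 0 := by
  have h𝒮 : ∀ k, 12 < k → centralPart T k = ⊥ := fun k hk => centralPart_eq_bot (hT.trans_lt hk)
  obtain ⟨R, hR₀, rfl⟩ := exists_mapMatrix_val_eq hR
  obtain ⟨R', hR₀', rfl⟩ := exists_mapMatrix_val_eq hR'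
  obtain ⟨c, hc₀, rfl⟩ := exists_val_eq hc
  have hφ := CentralForm.val_injective (T := T)
  set s : ℂ := Complex.I / (4 * Real.pi) with hs
  have hπ : (Real.pi : ℂ) ≠ 0 := by exact_mod_cast Real.pi_ne_zero
  have hs_two : Complex.I / (2 * Real.pi) = 2 * s := by rw [hs]; field_simp; norm_num
  have hs_sq : -(1 / (8 * (Real.pi : ℂ) ^ 2)) = 2 * s ^ 2 := by
    rw [hs, div_pow, Complex.I_sq]; field_simp; norm_num
  obtain ⟨M, hM_def⟩ : ∃ M, M = s • R := ⟨_, rfl⟩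
  obtain ⟨M', hM'_def⟩ : ∃ M', M' = s • R' := ⟨_, rfl⟩
  have hM : ∀ i j, M i j ∈ centralPart T 2 :=
    fun i j => hM_def ▸ Submodule.smul_mem _ _ (hR₀ i j)
  have hM' : ∀ i j, M' i j ∈ centralPart T 2 :=
    fun i j => hM'_def ▸ Submodule.smul_mem _ _ (hR₀' i j)
  -- every form is the image of the same expression in the ring of central forms
  rw [← map_smul, ← map_detSqrt hφ, ← hM_def] at hA
  rw [← map_smul, ← map_detSqrt hφ, ← hM'_def] at hD
  rw [hs_two, ← map_smul, ← map_evalSeries (mapMatrix_injective hφ), trace_mapMatrix,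
    mul_smul, ← hM'_def] at hch
  rw [hs_sq, ← map_pow, ← map_pow, trace_mapMatrix, trace_mapMatrix, ← map_smul,
    ← map_smul, ← map_sub] at hp
  rw [← map_smul, ← map_evalSeries hφ] at hC hS
  obtain ⟨E₀, hE₀⟩ : ∃ E₀, E₀ = evalSeries expSeries c + evalSeries expSeries (-c) - 2 := ⟨_, rfl⟩
  have hE' : E = CentralForm.val T E₀ := by
    rw [hE, hE₀, map_sub, map_add, map_evalSeries hφ, map_evalSeries hφ, map_neg, map_ofNat]
  rw [hp] at hQ hP
  rw [← map_evalSeries hφ] at hQ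
  rw [← map_smul, ← map_evalSeries hφ] at hP
  have hp₀ : (2 * s ^ 2) • (R ^ 2).trace - (2 * s ^ 2) • (R' ^ 2).trace
      = (2 : ℂ) • ((M ^ 2).trace - (M' ^ 2).trace) := by
    rw [hM_def, hM'_def, smul_pow, smul_pow, Matrix.trace_smul, Matrix.trace_smul, ← smul_sub,
      ← smul_sub, smul_smul]
  rw [hp₀] at hQ hP
  have hp_mem : (2 : ℂ) • ((M ^ 2).trace - (M' ^ 2).trace) ∈ centralPart T 4 :=
    Submodule.smul_mem _ _ (sub_mem (trace_pow_mem hM rfl) (trace_pow_mem hM' rfl))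
  obtain ⟨e, r₂, r₆, r₁₀, he, hr₂, hr₆, hr₁₀, hec⟩ := exists_trace_exp_eq_add h𝒮 hM'
  rw [he] at hch
  rw [hl, Nat.cast_mul, Nat.cast_two] at hec
  have cA := (hasComponents_detSqrt_sinhDivSeries_inv h𝒮 hM rfl rfl rfl).congr
    (one_smul _ _) (one_smul _ _) rfl rfl
  have cD := (hasComponents_detSqrt_two_smul_coshSeries h𝒮 hM' hl rfl rfl rfl).congr
    (b₂ := (2 ^ l : ℂ) • ((-1 / 24 : ℂ) • (M' ^ 4).trace + (1 / 32 : ℂ) • (M' ^ 2).trace ^ 2))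
    (b₃ := (2 ^ l : ℂ) • ((1 / 90 : ℂ) • (M' ^ 6).trace
      - (1 / 96 : ℂ) • ((M' ^ 2).trace * (M' ^ 4).trace) + (1 / 384 : ℂ) • (M' ^ 2).trace ^ 3))
    rfl rfl (by generalize (M' ^ 4).trace = t₄, (M' ^ 2).trace = t₂; algebra)
    (by generalize (M' ^ 6).trace = t₆, (M' ^ 4).trace = t₄, (M' ^ 2).trace = t₂; algebra)
  have cP := (hasComponents_evalSeries_of_mem_four h𝒮 expSeries
    (Submodule.smul_mem _ (1 / 24 : ℂ) hp_mem)).congr (b₀ := 1)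
    (b₁ := (1 / 12 : ℂ) • ((M ^ 2).trace - (M' ^ 2).trace))
    (by rw [coeff_expSeries.1, one_smul])
    (by rw [coeff_expSeries.2.1, smul_smul, smul_smul]; norm_num) rfl rfl
  have cQ := (hasComponents_evalSeries_of_mem_four h𝒮 expSubOneDivSeries hp_mem).congr
    (b₀ := (1 / 24 : ℂ) • 1) (by simp [expSubOneDivSeries]) rfl rfl rfl
  have cC := hasComponents_evalSeries_coshSeries h𝒮 hc₀
  have cS := hasComponents_evalSeries_coshSeries_sq_inv h𝒮 hc₀
  have cE := hasComponents_exp_add_exp_neg_sub_two h𝒮 hc₀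
  rw [← hE₀] at cE
  obtain ⟨⟨b₁, b₂, b₃, k0⟩, ⟨_, _, _, k4⟩, ⟨_, _, _, k8⟩, ⟨_, _, _, k12⟩⟩ :=
    exists_hasComponents_anomaly h𝒮 cA cD cP cQ cC cS cE hec
  have kPAC := cP.mul h𝒮 (cA.mul h𝒮 cC)
  rw [← hL] at k0 k4 k8 k12
  -- the components of the Chern character in degrees `2, 6, 10` do not contribute
  have hodd : ∀ (j : ℕ) (z : ℂ), j % 4 = 0 →
      degreePart j (P * (A * C) * (z • CentralForm.val T (r₂ + r₆ + r₁₀))) = 0 := by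
    intro j z hj
    rw [hP, hA, hC, mul_smul_comm, degreePart_smul, ← map_mul, ← map_mul, ← map_mul, mul_add,
      mul_add, map_add, map_add, degreePart_add, degreePart_add]
    rw [kPAC.degreePart_mul_eq_zero hr₂ rfl hj, kPAC.degreePart_mul_eq_zero hr₆ rfl hj,
      kPAC.degreePart_mul_eq_zero hr₁₀ rfl hj]
    simp
  have d0 := k0.degreePart_eq.1
  have d4 := k4.degreePart_eq.2.1
  have d8 := k8.degreePart_eq.2.2.1
  have d12 := k12.degreePart_eq.2.2.2
  simp only [map_mul, map_add, map_sub, map_smul, map_one, map_zero, ← hA, ← hD,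
    ← hP, ← hQ, ← hC, ← hS, ← hE'] at d0 d4 d8 d12
  refine ⟨d0, d4, ?_, ?_⟩
  · rw [← d8, ← sub_eq_zero, ← degreePart_sub, ← hodd 8 (L / 16) rfl, hch, map_add]
    congr 1
    simp only [smul_add, mul_add, mul_sub, mul_assoc, neg_smul, mul_neg]
    abel
  · rw [← d12, ← sub_eq_zero, ← degreePart_sub, ← hodd 12 (-(L / 8)) rfl, hch, map_add]
    congr 1
    simp only [smul_add, mul_add, mul_sub, mul_assoc, neg_smul, mul_neg]
    abel

/-- The degree `4 + j` part of `(1 + p Q) (U - V)` is that of `U - V` plus `p` times the degree `j`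
part of `Q (U - V)`. -/
theorem degreePart_sub_eq_mul {p P Q U V : Form T} (hp : p ∈ ⋀[ℂ]^4 (T →ₗ[ℝ] ℂ))
    (hP : P = 1 + p * Q) {j : ℕ} (h : degreePart (4 + j) (P * (U - V)) = 0) :
    degreePart (4 + j) U - degreePart (4 + j) V = p * degreePart j (Q * (V - U)) := by
  rw [hP, add_mul, one_mul, mul_assoc, degreePart_add, degreePart_add_mul hp, degreePart_sub] at h
  rw [← neg_sub U V, mul_neg, ← neg_one_smul ℂ, degreePart_smul, neg_one_smul, mul_neg]
  exact eq_neg_of_add_eq_zero_left h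

theorem trace_sq_mem {ι : Type*} [Fintype ι] [DecidableEq ι] {R : Matrix ι ι (Form T)}
    (hR : ∀ i j, R i j ∈ ⋀[ℂ]^2 (T →ₗ[ℝ] ℂ)) : (R ^ 2).trace ∈ ⋀[ℂ]^4 (T →ₗ[ℝ] ℂ) := by
  obtain ⟨R, hR₀, rfl⟩ := exists_mapMatrix_val_eq hR
  rw [← map_pow, trace_mapMatrix]
  exact mem_centralPart.1 (trace_pow_mem hR₀ rfl)

theorem pow_four_eq_zero [FiniteDimensional ℝ T] (hT : Module.finrank ℝ T ≤ 12) {p : Form T}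
    (hp : p ∈ ⋀[ℂ]^4 (T →ₗ[ℝ] ℂ)) : p ^ 4 = 0 := by
  have h := SetLike.pow_mem_graded (A := fun i : ℕ => ⋀[ℂ]^i (T →ₗ[ℝ] ℂ)) 4 hp
  have h16 : ⋀[ℂ]^(4 • 4) (T →ₗ[ℝ] ℂ) = ⊥ :=
    exteriorPower_eq_bot_of_finrank_lt (hT.trans_lt (by norm_num))
  exact (Submodule.mem_bot ℂ).1 (h16 ▸ h)

/-- The identities, for matrices `R` and `R'` of two-forms in place of the curvatures of `TX` and
`W`, and a two-form `c` in place of the Euler form. -/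
theorem anomaly_identities [FiniteDimensional ℝ T] (hT : Module.finrank ℝ T ≤ 12) {ι κ : Type*}
    [Fintype ι] [DecidableEq ι] [Fintype κ] [DecidableEq κ] {l : ℕ}
    (hl : Fintype.card κ = 2 * l) {R : Matrix ι ι (Form T)}
    (hR : ∀ i j, R i j ∈ ⋀[ℂ]^2 (T →ₗ[ℝ] ℂ)) {R' : Matrix κ κ (Form T)}
    (hR' : ∀ i j, R' i j ∈ ⋀[ℂ]^2 (T →ₗ[ℝ] ℂ)) {c : Form T} (hc : c ∈ ⋀[ℂ]^2 (T →ₗ[ℝ] ℂ))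
    {A D ch p C S E Q P K8 K12 : Form T} {t : ℤ → ℂ}
    (hA : A = detSqrt sinhDivSeries⁻¹ ((Complex.I / (4 * Real.pi)) • R))
    (hD : D = detSqrt ((2 : ℂ) • coshSeries) ((Complex.I / (4 * Real.pi)) • R'))
    (hch : ch = (evalSeries expSeries ((Complex.I / (2 * Real.pi)) • R')).trace)
    (hp : p = (-(1 / (8 * (Real.pi : ℂ) ^ 2))) • (R ^ 2).trace
      - (-(1 / (8 * (Real.pi : ℂ) ^ 2))) • (R' ^ 2).trace)
    (hC : C = evalSeries coshSeries ((1 / 2 : ℂ) • c))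
    (hS : S = evalSeries (coshSeries ^ 2)⁻¹ ((1 / 2 : ℂ) • c))
    (hE : E = evalSeries expSeries c + evalSeries expSeries (-c) - 2)
    (hQ : Q = evalSeries expSubOneDivSeries p)
    (hP : P = evalSeries expSeries ((1 / 24 : ℂ) • p)) (ht : ∀ k, t k = 2 ^ ((l : ℤ) + k))
    (hK8 : K8 = (-t (-4)) • ch + (t (-3) * (l + 8)) • (1 : Form T) + (3 * t (-4)) • E)
    (hK12 : K12 = t (-3) • ch - (t (-2) * (l - 4)) • (1 : Form T) - (3 * t (-3)) • E) :
    (degreePart 4 (A * D * S) + t 1 • degreePart 4 (A * C) = (-t (-3)) • p ∧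
      degreePart 4 (P * (A * D * S + t 1 • (A * C))) = 0) ∧
    (degreePart 8 (A * D * S) - degreePart 8 (A * K8 * C)
        = p * degreePart 4 (Q * (A * C * K8 - A * D * S)) ∧
      degreePart 8 (P * (A * D * S - A * C * K8)) = 0) ∧
    (degreePart 12 (A * D * S) - degreePart 12 (A * K12 * C)
        = p * degreePart 8 (Q * (A * C * K12 - A * D * S)) ∧
      degreePart 12 (P * (A * D * S - A * C * K12)) = 0) := by
  have hp_mem : p ∈ ⋀[ℂ]^4 (T →ₗ[ℝ] ℂ) := by
    rw [hp]
    exact sub_mem (Submodule.smul_mem _ _ (trace_sq_mem hR))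
      (Submodule.smul_mem _ _ (trace_sq_mem hR'))
  have hPQ : P = 1 + p * Q := by
    rw [hP, hQ, evalSeries_exp_eq_one_add_mul (pow_four_eq_zero hT hp_mem)]
  have hcomm : ∀ K : Form T, A * K * C = A * C * K := fun K => by
    rw [mul_assoc, mul_assoc, hC, mul_evalSeries_comm _ (Submodule.smul_mem _ _ hc)]
  obtain ⟨h0, h4, h8, h12⟩ := degreePart_anomaly hT hl hR hR' hc hA hD hch hp hC hS hE hQ hP rfl
  have ht1 : t 1 = 2 * 2 ^ l := by rw [ht, zpow_add₀ two_ne_zero, zpow_natCast]; ring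
  have ht2 : t (-2) = 2 ^ l / 4 := by rw [ht, zpow_add₀ two_ne_zero, zpow_natCast]; ring
  have ht3 : t (-3) = 2 ^ l / 8 := by rw [ht, zpow_add₀ two_ne_zero, zpow_natCast]; ring
  have ht4 : t (-4) = 2 ^ l / 16 := by rw [ht, zpow_add₀ two_ne_zero, zpow_natCast]; ring
  rw [← ht1] at h0 h4
  rw [← ht4, ← ht3, ← hK8] at h8
  rw [← ht3, ← ht2, ← hK12] at h12
  rw [← ht3] at h0
  rw [hcomm, hcomm]
  refine ⟨⟨?_, h4⟩, ⟨degreePart_sub_eq_mul hp_mem hPQ (j := 4) h8, h8⟩,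
    ⟨degreePart_sub_eq_mul hp_mem hPQ (j := 8) h12, h12⟩⟩
  -- in degree `4` the right-hand side is `-p` times the constant term `2^l / 8`
  have h := degreePart_sub_eq_mul hp_mem hPQ (j := 0) (U := A * D * S + t 1 • (A * C)) (V := 0)
    (by rwa [sub_zero])
  have hzero : degreePart 4 (0 : Form T) = 0 := map_zero _
  rw [zero_sub, mul_neg, ← neg_one_smul ℂ, degreePart_smul, h0, degreePart_add, degreePart_smul,
    hzero, sub_zero, smul_smul, neg_one_mul, mul_smul_comm, mul_one] at h
  exact h

end Forms

/-! ### Curvature and Euler forms -/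

section Bundles

variable {E : Type*} [NormedAddCommGroup E] [NormedSpace ℝ E] [FiniteDimensional ℝ E]
  {H : Type*} [TopologicalSpace H] {I : ModelWithCorners ℝ E H}
  {X : Type*} [TopologicalSpace X] [ChartedSpace H X] [IsManifold I ∞ X]

theorem curvatureMatrix_mem {F : Type*} [NormedAddCommGroup F] [NormedSpace ℝ F]
    [FiniteDimensional ℝ F] {V : X → Type*} [TopologicalSpace (TotalSpace F V)]
    [∀ x, NormedAddCommGroup (V x)] [∀ x, InnerProductSpace ℝ (V x)]
    [FiberBundle F V] [VectorBundle ℝ F V] (D : CovariantDerivative I F V) (x : X)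
    (a b : Fin (Module.finrank ℝ F)) :
    curvatureMatrix D x a b ∈ ⋀[ℂ]^2 (TangentSpace I x →ₗ[ℝ] ℂ) :=
by
  rw [curvatureMatrix, Matrix.of_apply]
  apply twoForm_mem

theorem eulerForm_mem {V : X → Type*} [TopologicalSpace (TotalSpace (EuclideanSpace ℝ (Fin 2)) V)]
    [∀ x, NormedAddCommGroup (V x)] [∀ x, InnerProductSpace ℝ (V x)]
    [FiberBundle (EuclideanSpace ℝ (Fin 2)) V] [VectorBundle ℝ (EuclideanSpace ℝ (Fin 2)) V]
    (o : ∀ x, Orientation ℝ (V x) (Fin 2))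
    (D : CovariantDerivative I (EuclideanSpace ℝ (Fin 2)) V) (x : X) :
    eulerForm o D x ∈ ⋀[ℂ]^2 (TangentSpace I x →ₗ[ℝ] ℂ) :=
by
  rw [eulerForm]
  refine Submodule.smul_mem _ _ ?_
  apply twoForm_mem

end Bundles

end Anomaly

theorem corollary1p5 {n l : ℕ}
    -- a smooth Riemannian manifold `X` of dimension `n` with its Levi-Civita connection `DX`
    {X : Type*} [TopologicalSpace X] [T2Space X] [ChartedSpace (EuclideanSpace ℝ (Fin n)) X]
    [IsManifold (𝓡 n) ∞ X]
    [RiemannianBundle (fun x : X => TangentSpace (𝓡 n) x)]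
    [IsContMDiffRiemannianBundle (𝓡 n) ∞ (EuclideanSpace ℝ (Fin n))
      (fun x : X => TangentSpace (𝓡 n) x)]
    (DX : CovariantDerivative (𝓡 n) (EuclideanSpace ℝ (Fin n))
      (fun x : X => TangentSpace (𝓡 n) x))
    [DX.ContMDiffCovariantDerivative ∞] (hDX : Anomaly.IsLeviCivita DX)
    -- a Euclidean vector bundle `W` of rank `2l` with a Euclidean connection `DW`
    {W : X → Type*} [TopologicalSpace (TotalSpace (EuclideanSpace ℝ (Fin (2 * l))) W)]
    [∀ x, NormedAddCommGroup (W x)] [∀ x, InnerProductSpace ℝ (W x)]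
    [FiberBundle (EuclideanSpace ℝ (Fin (2 * l))) W]
    [VectorBundle ℝ (EuclideanSpace ℝ (Fin (2 * l))) W]
    [ContMDiffVectorBundle ∞ (EuclideanSpace ℝ (Fin (2 * l))) W (𝓡 n)]
    [IsContMDiffRiemannianBundle (𝓡 n) ∞ (EuclideanSpace ℝ (Fin (2 * l))) W]
    (DW : CovariantDerivative (𝓡 n) (EuclideanSpace ℝ (Fin (2 * l))) W)
    [DW.ContMDiffCovariantDerivative ∞] (hDW : DW.IsMetricCompatible)
    -- an oriented Euclidean vector bundle `ξ` of rank `2` with a Euclidean connection `Dξ`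
    {ξ : X → Type*} [TopologicalSpace (TotalSpace (EuclideanSpace ℝ (Fin 2)) ξ)]
    [∀ x, NormedAddCommGroup (ξ x)] [∀ x, InnerProductSpace ℝ (ξ x)]
    [FiberBundle (EuclideanSpace ℝ (Fin 2)) ξ]
    [VectorBundle ℝ (EuclideanSpace ℝ (Fin 2)) ξ]
    [ContMDiffVectorBundle ∞ (EuclideanSpace ℝ (Fin 2)) ξ (𝓡 n)]
    [IsContMDiffRiemannianBundle (𝓡 n) ∞ (EuclideanSpace ℝ (Fin 2)) ξ]
    (o : ∀ x, Orientation ℝ (ξ x) (Fin 2)) (ho : Anomaly.IsBundleOrientation o)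
    (Dξ : CovariantDerivative (𝓡 n) (EuclideanSpace ℝ (Fin 2)) ξ)
    [Dξ.ContMDiffCovariantDerivative ∞] (hDξ : Dξ.IsMetricCompatible)
    (x : X) :
    let A := Anomaly.aHat DX x
    let D := Anomaly.detTwoCosh DW x
    let ch := Anomaly.chComplexified DW x
    let p := Anomaly.pontryagin₁ DX x - Anomaly.pontryagin₁ DW x
    let c := Anomaly.eulerForm o Dξ x
    let cosh := Anomaly.evalSeries Anomaly.coshSeries ((1 / 2 : ℂ) • c)
    let sech2 := Anomaly.evalSeries (Anomaly.coshSeries ^ 2)⁻¹ ((1 / 2 : ℂ) • c)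
    let ec := Anomaly.evalSeries Anomaly.expSeries c
      + Anomaly.evalSeries Anomaly.expSeries (-c) - 2
    -- `(e^{p/24} - 1) / p` and `e^{p/24}`
    let Q := Anomaly.evalSeries Anomaly.expSubOneDivSeries p
    let P := Anomaly.evalSeries Anomaly.expSeries ((1 / 24 : ℂ) • p)
    let t : ℤ → ℂ := fun k => (2 : ℂ) ^ ((l : ℤ) + k)
    -- the coefficients in dimensions 8 and 12
    let K8 := (-t (-4)) • ch + (t (-3) * (l + 8)) • (1 : Anomaly.Form (TangentSpace (𝓡 n) x))
    let K12 := t (-3) • ch - (t (-2) * (l - 4)) • (1 : Anomaly.Form (TangentSpace (𝓡 n) x))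
    let K8ξ := K8 + (3 * t (-4)) • ec
    let K12ξ := K12 - (3 * t (-3)) • ec
    -- (1) dimension 4
    (n = 4 →
      (Anomaly.degreePart 4 (A * D * sech2) + t 1 • Anomaly.degreePart 4 (A * cosh)
          = (-t (-3)) • p ∧
        Anomaly.degreePart 4 (P * (A * D * sech2 + t 1 • (A * cosh))) = 0) ∧
      (Anomaly.degreePart 4 (A * D) + t 1 • Anomaly.degreePart 4 A = (-t (-3)) • p ∧
        Anomaly.degreePart 4 (P * (A * D + t 1 • A)) = 0)) ∧
    -- (2) dimension 8
    (n = 8 →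
      (Anomaly.degreePart 8 (A * D * sech2) - Anomaly.degreePart 8 (A * K8ξ * cosh)
          = p * Anomaly.degreePart 4 (Q * (A * cosh * K8ξ - A * D * sech2)) ∧
        Anomaly.degreePart 8 (P * (A * D * sech2 - A * cosh * K8ξ)) = 0) ∧
      (Anomaly.degreePart 8 (A * D) - Anomaly.degreePart 8 (A * K8)
          = p * Anomaly.degreePart 4 (Q * (A * K8 - A * D)) ∧
        Anomaly.degreePart 8 (P * (A * D - A * K8)) = 0)) ∧
    -- (3) dimension 12
    (n = 12 →
      (Anomaly.degreePart 12 (A * D * sech2) - Anomaly.degreePart 12 (A * K12ξ * cosh)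
          = p * Anomaly.degreePart 8 (Q * (A * cosh * K12ξ - A * D * sech2)) ∧
        Anomaly.degreePart 12 (P * (A * D * sech2 - A * cosh * K12ξ)) = 0) ∧
      (Anomaly.degreePart 12 (A * D) - Anomaly.degreePart 12 (A * K12)
          = p * Anomaly.degreePart 8 (Q * (A * K12 - A * D)) ∧
        Anomaly.degreePart 12 (P * (A * D - A * K12)) = 0)) := by
  intro A D ch p c cosh sech2 ec Q P t K8 K12 K8ξ K12ξ
  have hn : n = 4 ∨ n = 8 ∨ n = 12 → Module.finrank ℝ (TangentSpace (𝓡 n) x) ≤ 12 := by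
    intro h
    have : Module.finrank ℝ (TangentSpace (𝓡 n) x) = n := finrank_euclideanSpace_fin
    omega
  have hW : Fintype.card (Fin (Module.finrank ℝ (EuclideanSpace ℝ (Fin (2 * l))))) = 2 * l := by
    simp
  have hξ := fun h => Anomaly.anomaly_identities (hn h) hW (R := Anomaly.curvatureMatrix DX x)
    (R' := Anomaly.curvatureMatrix DW x) (A := A) (D := D) (ch := ch) (p := p) (c := c)
    (C := cosh) (S := sech2) (E := ec) (Q := Q) (P := P) (t := t) (K8 := K8ξ) (K12 := K12ξ)
    (Anomaly.curvatureMatrix_mem DX x) (Anomaly.curvatureMatrix_mem DW x)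
    (Anomaly.eulerForm_mem o Dξ x) rfl rfl rfl rfl rfl rfl rfl rfl rfl
    (fun _ => rfl) rfl rfl
  -- the identities without `ξ` are the case `c = 0`
  have h0 := fun h => Anomaly.anomaly_identities (hn h) hW (R := Anomaly.curvatureMatrix DX x)
    (R' := Anomaly.curvatureMatrix DW x) (A := A) (D := D) (ch := ch) (p := p) (c := 0)
    (C := 1) (S := 1) (E := 0) (Q := Q) (P := P) (t := t) (K8 := K8) (K12 := K12)
    (Anomaly.curvatureMatrix_mem DX x) (Anomaly.curvatureMatrix_mem DW x)
    (zero_mem _) rfl rfl rfl rfl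
    (by rw [smul_zero, Anomaly.evalSeries_zero, Anomaly.coeff_coshSeries.1, one_smul])
    (by rw [smul_zero, Anomaly.evalSeries_zero, Anomaly.coeff_coshSeries_sq_inv.1, one_smul])
    (by rw [neg_zero, Anomaly.evalSeries_zero, Anomaly.coeff_expSeries.1, one_smul]; norm_num)
    rfl rfl (fun _ => rfl) (by rw [smul_zero, add_zero]) (by rw [smul_zero, sub_zero])
  simp only [mul_one] at h0
  exact ⟨fun h => ⟨(hξ (by omega)).1, (h0 (by omega)).1⟩,
    fun h => ⟨(hξ (by omega)).2.1, (h0 (by omega)).2.1⟩,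
    fun h => ⟨(hξ (by omega)).2.2, (h0 (by omega)).2.2⟩⟩
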